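/- Let $\Omega\subset\mathbb R^d$, $d\in\{2,3\}$, be a bounded polyhedral domain, let $k\ge 1$, $l\in\{k-1,k\}$, and let $\theta_*,l_*>0$. Consider partitions $\mathcal T_h$ of $\Omega$ into finitely many open polygons/polyhedra $K$, with set of (flat, relatively open) edges/faces $\varepsilon_h$, that are shape-regular with constants $\theta_*,l_*$: writing $h_K$ for the infimum of the diameters of the balls containing $K$, each $K$ is star-shaped with respect to every point of a ball of radius $\theta_*h_K$ centred at a point of $K$, and any two vertices of $K$ have distance at least $l_*h_K$. Put $(\cdot,\cdot)_{\mathcal T_h}=\sum_K(\cdot,\cdot)_{L^2(K)}$, $\langle\cdot,\cdot\rangle_{\partial\mathcal T_h}=\sum_K\langle\cdot,\cdot\rangle_{L^2(\partial K)}$, with norms $\|\cdot\|_{0,\mathcal T_h}$, $\|\cdot\|_{0,\partial\mathcal T_h}$, let $\bm n$ be the outer unit normal on $\partial K$, $\tau|_{\partial K}=h_K^{-1}$, and $$\bm Q_h=\{\bm r:\bm r|_K\in[P_{k-1}(K)]^d\},\quad V_h=\{w: w|_K\in P_k(K)\},\quad \widehat V_h=\{\mu:\mu|_e\in P_l(e)\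 \forall e\in\varepsilon_h,\ \mu=0\text{ on }\partial\Omega\}.$$ Let $\Pi_k^o$ be the $L^2(\Omega)$-projection onto $V_h$ and, on each face $e$ of each $K$, let $\Pi_l^\partial$ be the $L^2(e)$-projection onto $P_l(e)$ (applied to the trace from $K$). Define $\mathcal K_h:V_h\times\widehat V_h\to\bm Q_h$ by $$(\mathcal K_h(w,\mu),\bm r)_{\mathcal T_h}=-(w,\nabla\cdot\bm r)_{\mathcal T_h}+\langle\mu,\bm r\cdot\bm n\rangle_{\partial\mathcal T_h}\quad\forall\bm r\in\bm Q_h,$$ and, with $\bm b(v)=(v,\dots,v)^T\in\mathbb R^d$ and $\nu>0$, $$\mathcal S_h(u,\widehat u;w,\mu)=\nu\langle\tau(\Pi_l^\partial u-\widehat u),\Pi_l^\partial w-\mu\rangle_{\partial\mathcal T_h},$$ $$\mathcal B_h(v;u,\widehat u;w,\mu)=-\tfrac13(\bm b(v)u,\nabla w)_{\mathcal T_h}+\tfrac13(\bm b(v)\cdot\nabla u,w)_{\mathcal T_h}-\tfrac13\langle\bm b(v)\cdot\bm n\,u,\mu\rangle_{\partial\mathcal T_h}+\tfrac13\langle\bm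 b(v)\cdot\bm n\,\widehat u,w\rangle_{\partial\mathcal T_h},$$ $$|||(w,\mu)|||^2=\|\mathcal K_h(w,\mu)\|_{0,\mathcal T_h}^2+\|\tau^{1/2}(\Pi_l^\partial w-\mu)\|_{0,\partial\mathcal T_h}^2 .$$ Then there is a constant $C>0$, depending only on $\Omega,d,k,l,\theta_*,l_*$, such that the following holds for every such mesh, every $\nu>0$, $T>0$, $N\ge1$, with $\Delta t=T/N$, $t_n=n\Delta t$, every $u_0\in L^2(\Omega)$ and every $f$ with $f^n:=f(\cdot,t_n)\in L^2(\Omega)$ for $1\le n\le N$. If $u_h^0=\Pi_k^ou_0$ and, for $1\le n\le N$, $(\bm q_h^n,u_h^n,\widehat u_h^n)\in\bm Q_h\times V_h\times\widehat V_h$ satisfy $\bm q_h^n+\mathcal K_h(u_h^n,\widehat u_h^n)=0$ and $$\Big(\frac{u_h^n-u_h^{n-1}}{\Delta t},w\Big)_{\mathcal T_h}+\nu(\mathcal K_h(u_h^n,\widehat u_h^n),\mathcal K_h(w,\mu))_{\mathcal T_h}+\mathcal S_h(u_h^n,\widehat u_h^n;w,\mu)+\mathcal B_h(u_h^{n-1};u_h^n,\widehat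 u_h^n;w,\mu)=(f^n,w)_{\mathcal T_h}$$ for all $(w,\mu)\in V_h\times\widehat V_h$, then for every $1\le n\le N$ $$\|u_h^n\|_{0,\mathcal T_h}^2+\sum_{i=1}^n\|u_h^i-u_h^{i-1}\|_{0,\mathcal T_h}^2+\nu\Delta t\sum_{i=1}^n|||(u_h^i,\widehat u_h^i)|||^2\le C\Big(\|u_h^0\|_{0,\mathcal T_h}^2+\frac{\Delta t}{\nu}\sum_{i=1}^n\|f^i\|_{0,\mathcal T_h}^2\Big).$$ -/

import Mathlib

open MeasureTheory
open scoped MeasureTheory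

namespace HDG

/-- The Euclidean space `ℝ^d`. -/
abbrev Pt (d : ℕ) := EuclideanSpace ℝ (Fin d)

/-! ### Polytopes and polytopal meshes -/

/-- `S` is an open (relative to the affine subspace `A`), connected, bounded polygon / polyhedron in
`A`: its relative boundary `closure S \ S` lies in finitely many affine subspaces of codimension one
in `A`, and `S` is the relative interior of its closure (no slits). With `A = ⊤` this describes
polyhedral domains and mesh elements, with `A` a hyperplane it describes their faces. -/
structure IsOpenPolytope {d : ℕ} (A : AffineSubspace ℝ (Pt d)) (S : Set (Pt d)) : Prop where
  bounded : Bornology.IsBounded S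
  connected : IsConnected S
  relOpen : ∃ U : Set (Pt d), IsOpen U ∧ S = U ∩ A
  regular : ∀ U : Set (Pt d), IsOpen U → U ∩ A ⊆ closure S → U ∩ A ⊆ S
  boundary : ∃ F : Set (AffineSubspace ℝ (Pt d)), F.Finite ∧
    (∀ B ∈ F, Module.finrank ℝ B.direction + 1 = Module.finrank ℝ A.direction) ∧
    closure S \ S ⊆ ⋃ B ∈ F, (B : Set (Pt d))

/-- A partition of `Ω` into finitely many open polygons / polyhedra, together with the finite set of
its (relatively open) edges / faces. Straight angles are allowed, so hanging nodes are covered: an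
edge / face of the mesh may be a proper part of a flat part of the boundary of an element. -/
structure PolyMesh (d : ℕ) (Ω : Set (Pt d)) where
  elems : Finset (Set (Pt d))
  faces : Finset (Set (Pt d))
  elem_polytope : ∀ K ∈ elems, IsOpenPolytope ⊤ K
  elem_subset : ∀ K ∈ elems, K ⊆ Ω
  elem_disjoint : ∀ K ∈ elems, ∀ K' ∈ elems, K ≠ K' → Disjoint K K'
  elem_cover : closure Ω = ⋃ K ∈ elems, closure K
  face_polytope : ∀ e ∈ faces, ∃ A : AffineSubspace ℝ (Pt d),
    Module.finrank ℝ A.direction + 1 = d ∧ IsOpenPolytope A e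
  face_disjoint : ∀ e ∈ faces, ∀ e' ∈ faces, e ≠ e' → Disjoint e e'
  /-- The boundary of an element is the union of its closed faces. -/
  frontier_elem : ∀ K ∈ elems, frontier K = ⋃ e ∈ faces, ⋃ _ : e ⊆ frontier K, closure e
  /-- Every face is a boundary face, lying on `∂Ω` and on the boundary of an element, or an interior
  face, lying in `Ω` and shared by two elements. -/
  face_cases : ∀ e ∈ faces,
    (e ⊆ frontier Ω ∧ ∃ K ∈ elems, e ⊆ frontier K) ∨
    (e ⊆ Ω ∧ ∃ K ∈ elems, ∃ K' ∈ elems, K ≠ K' ∧ e ⊆ frontier K ∧ e ⊆ frontier K')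

/-- `h_K`: the infimum of the diameters of the balls that contain `K`. -/
noncomputable def size {d : ℕ} (K : Set (Pt d)) : ℝ :=
  sInf {δ : ℝ | ∃ c : Pt d, K ⊆ Metric.closedBall c (δ / 2)}

/-- `n` is the unit normal on the flat face `e` of `K` that points out of `K`: near every point of
`e`, the set `K` is the half space on the side of `e` opposite to `n`. -/
def IsOuterNormal {d : ℕ} (K e : Set (Pt d)) (n : Pt d) : Prop :=
  ‖n‖ = 1 ∧ ∀ x ∈ e, ∃ ε > 0, ∀ y ∈ Metric.ball x ε, y ∈ K ↔ inner ℝ n (y - x) < 0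

/-- The outer unit normal of `K` on its face `e`. -/
noncomputable def outerNormal {d : ℕ} (K e : Set (Pt d)) : Pt d :=
  Classical.epsilon (IsOuterNormal K e)

namespace PolyMesh

variable {d : ℕ} {Ω : Set (Pt d)}

/-- The vertices of the element `K` in the mesh: the points of its boundary near which the faces of
`K` are not all invariant under translation along some line. (Inside a face, and in three dimensions
inside an edge, there is such a line.) -/
def vertices (M : PolyMesh d Ω) (K : Set (Pt d)) : Set (Pt d) :=
  {x ∈ frontier K | ¬ ∃ v : Pt d, v ≠ 0 ∧ ∃ ε > 0, ∀ e ∈ M.faces, e ⊆ frontier K →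
    ∀ (y : Pt d) (t : ℝ), y ∈ Metric.ball x ε → y + t • v ∈ Metric.ball x ε →
      (y ∈ e ↔ y + t • v ∈ e)}

/-- Shape regularity with constants `θ` and `ℓ`: every element `K` is star-shaped with respect to
all points of a ball of radius `θ h_K` centred in `K`, and its vertices have distance at least
`ℓ h_K` from each other. -/
structure ShapeRegular (M : PolyMesh d Ω) (θ ℓ : ℝ) : Prop where
  starShaped : ∀ K ∈ M.elems, ∃ c ∈ K, ∀ y ∈ Metric.ball c (θ * size K), StarConvex ℝ y K
  vertex_dist : ∀ K ∈ M.elems, ∀ x ∈ M.vertices K, ∀ y ∈ M.vertices K, x ≠ y →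
    ℓ * size K ≤ dist x y

end PolyMesh

/-! ### Polynomials -/

/-- `P_m`: the real polynomials in `d` variables of total degree at most `m`. -/
noncomputable abbrev Poly (d m : ℕ) : Submodule ℝ (MvPolynomial (Fin d) ℝ) :=
  MvPolynomial.restrictTotalDegree (Fin d) ℝ m

/-- The value of a polynomial at a point. -/
noncomputable def val {d : ℕ} (p : MvPolynomial (Fin d) ℝ) (x : Pt d) : ℝ :=
  MvPolynomial.eval (fun i => x i) p

/-- The value of a polynomial vector field at a point. -/
noncomputable def vval {d : ℕ} (r : Fin d → MvPolynomial (Fin d) ℝ) (x : Pt d) : Pt d :=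
  WithLp.toLp 2 fun i => val (r i) x

/-- The gradient of a polynomial at a point. -/
noncomputable def grad {d : ℕ} (p : MvPolynomial (Fin d) ℝ) (x : Pt d) : Pt d :=
  vval (fun i => MvPolynomial.pderiv i p) x

/-- The divergence of a polynomial vector field at a point. -/
noncomputable def div {d : ℕ} (r : Fin d → MvPolynomial (Fin d) ℝ) (x : Pt d) : ℝ :=
  ∑ i, val (MvPolynomial.pderiv i (r i)) x

/-- The vector `b(s) = (s, …, s)`. -/
noncomputable def bvec (d : ℕ) (s : ℝ) : Pt d := WithLp.toLp 2 fun _ => s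

/-- `p` is an `L²(μ)`-projection of `g` onto the polynomials of degree at most `m`. -/
def IsPolyProj {d : ℕ} (μ : Measure (Pt d)) (m : ℕ) (g : Pt d → ℝ)
    (p : MvPolynomial (Fin d) ℝ) : Prop :=
  p ∈ Poly d m ∧ ∀ q ∈ Poly d m, ∫ x, val p x * val q x ∂μ = ∫ x, g x * val q x ∂μ

/-- The `L²(μ)`-projection of `g` onto the polynomials of degree at most `m`. (Its values are
determined `μ`-almost everywhere.) -/
noncomputable def polyProj {d : ℕ} (μ : Measure (Pt d)) (m : ℕ) (g : Pt d → ℝ) :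
    MvPolynomial (Fin d) ℝ :=
  Classical.epsilon (IsPolyProj μ m g)

/-- The surface measure on a face `e` (length for `d = 2`, area for `d = 3`). -/
noncomputable def surf {d : ℕ} (e : Set (Pt d)) : Measure (Pt d) :=
  (μHE[d - 1] : Measure (Pt d)).restrict e

namespace PolyMesh

variable {d : ℕ} {Ω : Set (Pt d)}

/-! ### The finite element spaces

A piecewise polynomial is the family of its polynomials on the elements. Its trace on `∂K` is the
trace of the polynomial on `K`. -/

/-- Scalar piecewise polynomials. -/
abbrev Scal (M : PolyMesh d Ω) := M.elems → MvPolynomial (Fin d) ℝ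

/-- Piecewise polynomial vector fields. -/
abbrev Vect (M : PolyMesh d Ω) := M.elems → Fin d → MvPolynomial (Fin d) ℝ

/-- Piecewise polynomials on the faces. A polynomial on a face `e` is the restriction to `e` of a
polynomial of the same degree on `ℝ^d`; nothing below depends on its values outside `e`. -/
abbrev Skel (M : PolyMesh d Ω) := M.faces → MvPolynomial (Fin d) ℝ

/-- The space `V_h`. -/
def Vh (M : PolyMesh d Ω) (k : ℕ) : Set M.Scal := {w | ∀ K, w K ∈ Poly d k}

/-- The space `Q_h`, of piecewise degree `k - 1`. -/
def Qh (M : PolyMesh d Ω) (k : ℕ) : Set M.Vect := {r | ∀ K i, r K i ∈ Poly d (k - 1)}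

/-- The space of numerical traces, which vanish on the boundary faces. -/
def Vhat (M : PolyMesh d Ω) (l : ℕ) : Set M.Skel :=
  {μ | ∀ e, μ e ∈ Poly d l ∧ (e.1 ⊆ frontier Ω → ∀ x ∈ e.1, val (μ e) x = 0)}

/-! ### Inner products and forms -/

/-- `∑_K ∫_K g_K`. -/
noncomputable def elemInt (M : PolyMesh d Ω) (g : M.elems → Pt d → ℝ) : ℝ :=
  ∑ K : M.elems, ∫ x in K.1, g K x

open scoped Classical in
/-- `∑_K ∫_{∂K} g_K`, where `g_K` is given on each face `e` of `K`. -/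
noncomputable def bdryInt (M : PolyMesh d Ω) (g : M.elems → M.faces → Pt d → ℝ) : ℝ :=
  ∑ K : M.elems, ∑ e : M.faces with e.1 ⊆ frontier K.1, ∫ x, g K e x ∂(surf e.1)

/-- The squared norm `‖g‖²_{0,𝒯_h}`. -/
noncomputable def normSq (M : PolyMesh d Ω) (g : M.elems → Pt d → ℝ) : ℝ :=
  M.elemInt fun K x => g K x ^ 2

/-- `q = 𝒦_h(w, μ)`, that is `q ∈ Q_h` and `(q, r) = -(w, ∇·r) + ⟨μ, r·n⟩` for all `r ∈ Q_h`. -/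
def IsKh (M : PolyMesh d Ω) (k : ℕ) (w : M.Scal) (μ : M.Skel) (q : M.Vect) : Prop :=
  q ∈ M.Qh k ∧ ∀ r ∈ M.Qh k,
    M.elemInt (fun K x => inner ℝ (vval (q K) x) (vval (r K) x)) =
      - M.elemInt (fun K x => val (w K) x * div (r K) x)
      + M.bdryInt (fun K e x => val (μ e) x * inner ℝ (vval (r K) x) (outerNormal K.1 e.1))

/-- The operator `𝒦_h`. -/
noncomputable def Kh (M : PolyMesh d Ω) (k : ℕ) (w : M.Scal) (μ : M.Skel) : M.Vect :=
  Classical.epsilon (M.IsKh k w μ)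

/-- The values on the face `e` of `K` of `Π_l^∂ w - μ`. The projection of the trace of `w` from `K`
is taken face by face. -/
noncomputable def traceGap (M : PolyMesh d Ω) (l : ℕ) (w : M.Scal) (μ : M.Skel)
    (K : M.elems) (e : M.faces) (x : Pt d) : ℝ :=
  val (polyProj (surf e.1) l (val (w K))) x - val (μ e) x

/-- The stabilization form `𝒮_h(u, û; w, μ)`, with `τ = 1 / h_K` on `∂K`. -/
noncomputable def Sh (M : PolyMesh d Ω) (l : ℕ) (ν : ℝ) (u : M.Scal) (uhat : M.Skel)
    (w : M.Scal) (μ : M.Skel) : ℝ :=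
  ν * M.bdryInt fun K e x =>
    (size K.1)⁻¹ * M.traceGap l u uhat K e x * M.traceGap l w μ K e x

/-- The convection form `ℬ_h(v; u, û; w, μ)`. -/
noncomputable def Bh (M : PolyMesh d Ω) (v u : M.Scal) (uhat : M.Skel)
    (w : M.Scal) (μ : M.Skel) : ℝ :=
  - (1 / 3) * M.elemInt (fun K x => val (u K) x * inner ℝ (bvec d (val (v K) x)) (grad (w K) x))
  + (1 / 3) * M.elemInt (fun K x => inner ℝ (bvec d (val (v K) x)) (grad (u K) x) * val (w K) x)
  - (1 / 3) * M.bdryInt (fun K e x =>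
      inner ℝ (bvec d (val (v K) x)) (outerNormal K.1 e.1) * val (u K) x * val (μ e) x)
  + (1 / 3) * M.bdryInt (fun K e x =>
      inner ℝ (bvec d (val (v K) x)) (outerNormal K.1 e.1) * val (uhat e) x * val (w K) x)

/-- The square of the mesh-dependent norm `|||(w, μ)|||`. -/
noncomputable def tripleNormSq (M : PolyMesh d Ω) (k l : ℕ) (w : M.Scal) (μ : M.Skel) : ℝ :=
  M.elemInt (fun K x => ‖vval (M.Kh k w μ K) x‖ ^ 2)
  + M.bdryInt (fun K e x => (size K.1)⁻¹ * M.traceGap l w μ K e x ^ 2)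

/-- `(q n, u n, uhat n)`, `1 ≤ n ≤ N`, and `u 0` solve the linearized backward Euler HDG scheme with
time step `Δt = T / N`, initial value `u 0 = Π_k^o u₀` and source terms `f^n = f (n Δt)`. The values
`q 0` and `uhat 0` play no role. -/
structure IsBackwardEuler (M : PolyMesh d Ω) (k l : ℕ) (ν T : ℝ) (N : ℕ) (u₀ : Pt d → ℝ)
    (f : ℝ → Pt d → ℝ) (q : ℕ → M.Vect) (u : ℕ → M.Scal) (uhat : ℕ → M.Skel) : Prop where
  initial : ∀ K : M.elems, IsPolyProj (volume.restrict K.1) k u₀ (u 0 K)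
  mem : ∀ n, 1 ≤ n → n ≤ N → q n ∈ M.Qh k ∧ u n ∈ M.Vh k ∧ uhat n ∈ M.Vhat l
  flux : ∀ n, 1 ≤ n → n ≤ N → q n + M.Kh k (u n) (uhat n) = 0
  step : ∀ n, 1 ≤ n → n ≤ N → ∀ w ∈ M.Vh k, ∀ μ ∈ M.Vhat l,
    M.elemInt (fun K x => (val (u n K) x - val (u (n - 1) K) x) / (T / N) * val (w K) x)
    + ν * M.elemInt (fun K x =>
        inner ℝ (vval (M.Kh k (u n) (uhat n) K) x) (vval (M.Kh k w μ K) x))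
    + M.Sh l ν (u n) (uhat n) w μ
    + M.Bh (u (n - 1)) (u n) (uhat n) w μ
    = M.elemInt (fun K x => f (n * (T / N)) x * val (w K) x)

end PolyMesh

end HDG

namespace HDG

variable {d : ℕ}

/-! ### Calculus of polynomials -/

/-! The estimate is an energy argument. Testing the scheme with (uⁿ, ûⁿ) kills the convection form,
which is skew-symmetric for every advecting field (`Bh_self`). The time difference is polarized by
2a(a - b) = a² + (a - b)² - b², and the other two forms add up to ν|||(uⁿ, ûⁿ)|||². The source term
is absorbed by Young's inequality once ‖w‖² ≤ P|||(w, μ)|||² is known, and the one-step bounds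
(`energy_step`) telescope. The weight lies in this discrete Poincaré inequality
(`exists_poincare_const`), with P independent of the mesh.

For the Poincaré inequality, integrate the divergence of w²(x₁ - a)e₁ over each element. The same
flux with μ² in place of w² vanishes in total, because μ is single-valued and zero on ∂Ω while the
two normals at an interior face are opposite (`bdryInt_singleValued`). So ‖w‖² is controlled by ∇w
and by h⁻¹(w - μ)² on the skeleton, up to terms that a trace inequality absorbs (`elemInt_sq_le`).
Splitting w - μ = (w - Πw) + (Πw - μ), the first part is bounded by the oscillation of w, hence by
∇w, and the second by the stabilization. Finally ∇w is bounded by the triple norm: test the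
definition of 𝒦_h with r = ∇w and use that ∇w·n lies in P_{k-1} ⊆ P_l, so that w may be replaced by
Πw on faces (`elemInt_Kh_grad`, `elemInt_grad_le`).

The trace constants must not depend on the shape or number of faces (`exists_trace_const`). A
polynomial is bounded pointwise by its L² norm on the ball of star centres, by norm equivalence and
scaling (`exists_sup_le`), and the area satisfies r|∂K| ≤ d|K| by the divergence theorem for x - c.

The divergence theorem itself (`StarPolytope.integral_pderiv`) comes from cutting K into cones over
its faces with apex a star centre y. The field (x - y)g is tangent to the sides of the cones and can
be integrated along rays; subtracting the identities for two apexes leaves a constant direction. -/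

@[simp] lemma val_add (p q : MvPolynomial (Fin d) ℝ) (x : Pt d) :
    val (p + q) x = val p x + val q x := by simp [val]

@[simp] lemma val_sub (p q : MvPolynomial (Fin d) ℝ) (x : Pt d) :
    val (p - q) x = val p x - val q x := by simp [val]

@[simp] lemma val_mul (p q : MvPolynomial (Fin d) ℝ) (x : Pt d) :
    val (p * q) x = val p x * val q x := by simp [val]

@[simp] lemma val_smul (a : ℝ) (p : MvPolynomial (Fin d) ℝ) (x : Pt d) :
    val (a • p) x = a * val p x := by simp [val, MvPolynomial.smul_eval]

@[simp] lemma val_C (a : ℝ) (x : Pt d) : val (MvPolynomial.C a) x = a := by simp [val]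

@[simp] lemma val_X (i : Fin d) (x : Pt d) : val (MvPolynomial.X i) x = x i := by simp [val]

@[simp] lemma val_zero (x : Pt d) : val (0 : MvPolynomial (Fin d) ℝ) x = 0 := by simp [val]

@[simp] lemma val_one (x : Pt d) : val (1 : MvPolynomial (Fin d) ℝ) x = 1 := by simp [val]

@[simp] lemma val_pow (p : MvPolynomial (Fin d) ℝ) (n : ℕ) (x : Pt d) :
    val (p ^ n) x = val p x ^ n := by simp [val]

@[simp] lemma val_sum {ι : Type*} (s : Finset ι) (p : ι → MvPolynomial (Fin d) ℝ) (x : Pt d) :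
    val (∑ i ∈ s, p i) x = ∑ i ∈ s, val (p i) x := by simp [val]

@[simp] lemma vval_apply (r : Fin d → MvPolynomial (Fin d) ℝ) (x : Pt d) (i : Fin d) :
    vval r x i = val (r i) x := rfl

@[simp] lemma grad_apply (p : MvPolynomial (Fin d) ℝ) (x : Pt d) (i : Fin d) :
    grad p x i = val (MvPolynomial.pderiv i p) x := rfl

lemma inner_eq_sum (x y : Pt d) : inner ℝ x y = ∑ i, x i * y i := by
  simp [PiLp.inner_apply, mul_comm]

@[fun_prop] lemma continuous_val (p : MvPolynomial (Fin d) ℝ) : Continuous (val p) := by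
  unfold val
  have h := MvPolynomial.continuous_eval p
  fun_prop

@[fun_prop] lemma continuous_vval (r : Fin d → MvPolynomial (Fin d) ℝ) : Continuous (vval r) := by
  unfold vval
  fun_prop

@[fun_prop] lemma continuous_grad (p : MvPolynomial (Fin d) ℝ) : Continuous (grad p) := by
  unfold grad
  fun_prop

@[fun_prop] lemma continuous_div (r : Fin d → MvPolynomial (Fin d) ℝ) : Continuous (div r) := by
  unfold div
  fun_prop

/-- The derivative of a polynomial along a line. -/
lemma hasDerivAt_val_line (p : MvPolynomial (Fin d) ℝ) (y z : Pt d) (s : ℝ) :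
    HasDerivAt (fun s : ℝ => val p (y + s • z)) (inner ℝ z (grad p (y + s • z))) s := by
  simp only [inner_eq_sum, grad_apply]
  induction p using MvPolynomial.induction_on with
  | C a => simpa using hasDerivAt_const s a
  | add p q hp hq =>
    have h := hp.add hq
    simp only [val_add, map_add, mul_add, Finset.sum_add_distrib]
    exact h
  | mul_X p i hp =>
    have hx : HasDerivAt (fun s : ℝ => (y + s • z) i) (z i) s := by
      simpa using ((hasDerivAt_id s).mul_const (z i)).const_add (y i)
    have h := hp.mul hx
    simp only [val_mul, val_X]
    refine h.congr_deriv ?_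
    rw [Finset.sum_mul]
    simp only [Derivation.leibniz, smul_eq_mul, val_add, val_mul, val_X, mul_add,
      Finset.sum_add_distrib, MvPolynomial.pderiv_X]
    rw [add_comm]
    refine congrArg₂ (· + ·) ?_ ?_
    · rw [Finset.sum_eq_single i]
      · simp [mul_comm]
      · intro j _ hj
        simp [hj.symm]
      · simp
    · exact Finset.sum_congr rfl fun j _ => by ring

lemma mem_poly_iff {m : ℕ} {p : MvPolynomial (Fin d) ℝ} : p ∈ Poly d m ↔ p.totalDegree ≤ m :=
  MvPolynomial.mem_restrictTotalDegree _ _ _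

lemma poly_mono {m n : ℕ} (h : m ≤ n) : Poly d m ≤ Poly d n := fun _ hp =>
  mem_poly_iff.2 ((mem_poly_iff.1 hp).trans h)

/-- A monomial m of the derivative comes from the monomial m·xᵢ of p. The truncated subtraction is
harmless, since constants have derivative zero. -/
lemma totalDegree_pderiv_le (i : Fin d) (p : MvPolynomial (Fin d) ℝ) :
    (MvPolynomial.pderiv i p).totalDegree ≤ p.totalDegree - 1 := by
  refine Finset.sup_le fun m hm => ?_
  have hm' : m + Finsupp.single i 1 ∈ p.support := by
    rw [MvPolynomial.mem_support_iff, MvPolynomial.coeff_pderiv] at hm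
    exact MvPolynomial.mem_support_iff.2 (left_ne_zero_of_mul hm)
  have h := MvPolynomial.le_totalDegree hm'
  rw [Finsupp.sum_add_index' (fun _ => rfl) (fun _ _ _ => rfl), Finsupp.sum_single_index rfl] at h
  omega

lemma pderiv_mem_poly {m : ℕ} {p : MvPolynomial (Fin d) ℝ} (hp : p ∈ Poly d m) (i : Fin d) :
    MvPolynomial.pderiv i p ∈ Poly d (m - 1) := 
  mem_poly_iff.2 ((totalDegree_pderiv_le i p).trans (Nat.sub_le_sub_right (mem_poly_iff.1 hp) 1))

/-- Precomposition of a polynomial with the homothety `x ↦ c + h x`. -/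
noncomputable def rescale (c : Pt d) (h : ℝ) :
    MvPolynomial (Fin d) ℝ →ₐ[ℝ] MvPolynomial (Fin d) ℝ :=
  MvPolynomial.aeval fun i => MvPolynomial.C (c i) + h • MvPolynomial.X i

@[simp] lemma val_rescale (c : Pt d) (h : ℝ) (p : MvPolynomial (Fin d) ℝ) (x : Pt d) :
    val (rescale c h p) x = val p (c + h • x) := by
  induction p using MvPolynomial.induction_on with
  | C a => simp [rescale, val]
  | add p q hp hq => simp [hp, hq]
  | mul_X p i hp => rw [map_mul, val_mul, hp]; simp [rescale]

lemma rescale_mem_poly {m : ℕ} (c : Pt d) (h : ℝ) {p : MvPolynomial (Fin d) ℝ}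
    (hp : p ∈ Poly d m) : rescale c h p ∈ Poly d m := by
  rw [mem_poly_iff] at *
  refine le_trans ?_ hp
  conv_lhs => rw [p.as_sum, map_sum]
  refine (MvPolynomial.totalDegree_finsetSum _ _).trans (Finset.sup_le fun s hs => ?_)
  rw [rescale, MvPolynomial.aeval_monomial]
  refine (MvPolynomial.totalDegree_mul _ _).trans ?_
  simp only [MvPolynomial.algebraMap_eq, MvPolynomial.totalDegree_C, zero_add]
  refine le_trans ?_ (MvPolynomial.le_totalDegree hs)
  refine (MvPolynomial.totalDegree_finsetProd _ _).trans (Finset.sum_le_sum fun i _ => ?_)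
  refine (MvPolynomial.totalDegree_pow _ _).trans ?_
  refine (Nat.mul_le_mul_left _ ?_).trans (mul_one _).le
  refine (MvPolynomial.totalDegree_add _ _).trans (max_le (by simp) ?_)
  exact (MvPolynomial.totalDegree_smul_le _ _).trans (by simp)

/-- A polynomial that vanishes on a nonempty open set is zero. -/
lemma eq_zero_of_val_eq_zero {U : Set (Pt d)} (hU : IsOpen U) (hne : U.Nonempty)
    {p : MvPolynomial (Fin d) ℝ} (h : ∀ x ∈ U, val p x = 0) : p = 0 := by
  obtain ⟨x, hx⟩ := hne
  have hU' : IsOpen ((WithLp.toLp 2 : (Fin d → ℝ) → Pt d) ⁻¹' U) :=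
    hU.preimage (PiLp.continuous_toLp 2 _)
  obtain ⟨ε, hε, hs⟩ := Metric.isOpen_iff.1 hU' (WithLp.ofLp x) (by simpa using hx)
  -- A ball for the sup norm is a product of infinite sets, on which vanishing polynomials are zero.
  refine MvPolynomial.funext_set (fun i => Metric.ball (x i) ε) (fun i => ?_) fun z hz => ?_
  · rw [Real.ball_eq_Ioo]; exact Set.Ioo_infinite (by linarith)
  · have : z ∈ Metric.ball (WithLp.ofLp x) ε := by
      rw [ball_pi _ hε]; simpa [Set.mem_pi] using hz
    have := h _ (hs this)
    simpa [val] using this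

/-- A continuous function is integrable for every finite measure concentrated on a bounded set. -/
lemma integrable_of_bounded {μ : Measure (Pt d)} {S : Set (Pt d)} (hS : Bornology.IsBounded S)
    (hμ : μ S ≠ ⊤) (hS' : MeasurableSet S) {g : Pt d → ℝ} (hg : Continuous g) :
    Integrable g (μ.restrict S) := by
  obtain ⟨C, hC⟩ := (hS.isCompact_closure.image hg).isBounded.exists_norm_le
  have : IsFiniteMeasure (μ.restrict S) := ⟨by simpa using hμ.lt_top⟩
  refine Integrable.of_bound hg.aestronglyMeasurable C ?_
  filter_upwards [ae_restrict_mem hS'] with x hx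
  exact hC _ (Set.mem_image_of_mem _ (subset_closure hx))

end HDG

namespace HDG

variable {d : ℕ}

/-! ### Sets that are star-shaped with respect to a ball -/

/-- `K` is open, bounded, and star-shaped with respect to every point of `ball c r`. -/
structure StarBall (K : Set (Pt d)) (c : Pt d) (r : ℝ) : Prop where
  isOpen : IsOpen K
  bounded : Bornology.IsBounded K
  pos : 0 < r
  mem : c ∈ K
  star : ∀ y ∈ Metric.ball c r, StarConvex ℝ y K

/-- `e` is a nonempty bounded relatively open subset of the hyperplane `A`. -/
structure FlatPiece (A : AffineSubspace ℝ (Pt d)) (e : Set (Pt d)) : Prop where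
  finrank : Module.finrank ℝ A.direction + 1 = d
  bounded : Bornology.IsBounded e
  nonempty : e.Nonempty
  relOpen : ∃ U : Set (Pt d), IsOpen U ∧ e = U ∩ A

namespace StarBall

variable {K e : Set (Pt d)} {c : Pt d} {r : ℝ} {A : AffineSubspace ℝ (Pt d)}

lemma ball_subset (hK : StarBall K c r) : Metric.ball c r ⊆ K := fun y hy =>
  (hK.star y hy).mem ⟨c, hK.mem⟩

/-- Star-shapedness with respect to a whole ball reaches closure points: replace x by a nearby point
of K and move the centre y slightly so that the point on the segment stays the same. -/
lemma mem_of_mem_closure (hK : StarBall K c r) {x y : Pt d} (hx : x ∈ closure K)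
    (hy : y ∈ Metric.ball c r) {t : ℝ} (ht0 : 0 ≤ t) (ht1 : t < 1) : y + t • (x - y) ∈ K := by
  have hs : 0 < 1 - t := by linarith
  have hcont : Continuous fun x' : Pt d => y + (t / (1 - t)) • (x - x') := by fun_prop
  have hopen : IsOpen ((fun x' : Pt d => y + (t / (1 - t)) • (x - x')) ⁻¹' Metric.ball c r) :=
    Metric.isOpen_ball.preimage hcont
  obtain ⟨x', hx'1, hx'K⟩ := mem_closure_iff.1 hx _ hopen (by simpa using hy)
  have h := (hK.star _ hx'1) hx'K hs.le ht0 (by ring)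
  convert h using 1
  simp only [smul_add, smul_sub, smul_smul]
  rw [mul_div_cancel₀ _ hs.ne']
  module

lemma disjoint_frontier (hK : StarBall K c r) {x : Pt d} (hx : x ∈ frontier K) : x ∉ K := by
  rw [hK.isOpen.frontier_eq] at hx
  exact hx.2

/-- The hyperplane of a boundary face does not meet the ball of star centres. -/
lemma notMem_of_mem_ball (hK : StarBall K c r) (he : FlatPiece A e) (heK : e ⊆ frontier K)
    {y : Pt d} (hy : y ∈ Metric.ball c r) : y ∉ A := by
  intro hyA
  obtain ⟨x, hx⟩ := he.nonempty
  obtain ⟨U, hU, rfl⟩ := he.relOpen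
  have hcont : Continuous fun t : ℝ => y + t • (x - y) := by fun_prop
  have hopen := hU.preimage hcont
  have h1 : (1 : ℝ) ∈ (fun t : ℝ => y + t • (x - y)) ⁻¹' U := by simpa using hx.1
  obtain ⟨ε, hε, hs⟩ := Metric.isOpen_iff.1 hopen 1 h1
  -- If y were in A, the points of the segment from y just before x would lie in e, hence on the
  -- frontier, and also in the open set K.
  set t : ℝ := max 0 (1 - ε / 2) with ht
  have ht0 : 0 ≤ t := le_max_left _ _
  have ht1 : t < 1 := max_lt one_pos (by linarith)
  have htb : t ∈ Metric.ball (1 : ℝ) ε := by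
    rw [Metric.mem_ball, Real.dist_eq, abs_sub_comm, abs_of_pos (by linarith)]
    have : 1 - ε / 2 ≤ t := le_max_right _ _
    linarith
  have hA : y + t • (x - y) ∈ A := by
    have := AffineMap.lineMap_mem t hyA hx.2
    rwa [AffineMap.lineMap_apply, vsub_eq_sub, vadd_eq_add, add_comm] at this
  exact hK.disjoint_frontier (heK ⟨hs htb, hA⟩)
    (hK.mem_of_mem_closure (frontier_subset_closure (heK hx)) hy ht0 ht1)

end StarBall

/-- A hyperplane has a unit normal. -/
lemma exists_unit_normal {A : AffineSubspace ℝ (Pt d)} (hA : Module.finrank ℝ A.direction + 1 = d) :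
    ∃ n : Pt d, ‖n‖ = 1 ∧ A.direction = (ℝ ∙ n)ᗮ := by
  have h1 : Module.finrank ℝ A.directionᗮ = 1 := by
    have := A.direction.finrank_add_finrank_orthogonal
    rw [finrank_euclideanSpace_fin] at this
    omega
  obtain ⟨v, hv0, hv⟩ := finrank_eq_one_iff'.1 h1
  have hv' : (v : Pt d) ≠ 0 := by simpa using hv0
  have hspan : A.directionᗮ = ℝ ∙ (v : Pt d) := by
    refine le_antisymm (fun w hw => ?_) ((Submodule.span_singleton_le_iff_mem _ _).2 v.2)
    obtain ⟨a, ha⟩ := hv ⟨w, hw⟩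
    exact Submodule.mem_span_singleton.2 ⟨a, by simpa using congrArg Subtype.val ha⟩
  refine ⟨‖(v : Pt d)‖⁻¹ • (v : Pt d), norm_smul_inv_norm (𝕜 := ℝ) hv', ?_⟩
  rw [Submodule.span_singleton_smul_eq (IsUnit.mk0 _ (inv_ne_zero (norm_ne_zero_iff.2 hv'))),
    ← hspan, Submodule.orthogonal_orthogonal]

lemma mem_iff_inner_eq_zero {A : AffineSubspace ℝ (Pt d)} {n : Pt d} (hA : A.direction = (ℝ ∙ n)ᗮ)
    {x z : Pt d} (hx : x ∈ A) : z ∈ A ↔ inner ℝ n (z - x) = 0 := by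
  rw [← AffineSubspace.vsub_right_mem_direction_iff_mem hx, hA,
    Submodule.mem_orthogonal_singleton_iff_inner_right, vsub_eq_sub]

namespace IsOuterNormal

variable {K K' e : Set (Pt d)} {n n' : Pt d}

/-- If n ≠ n', a small step from a point of e along n' - n enters K according to n and leaves it
according to n'. Uniqueness identifies the chosen `outerNormal` with the geometric one. -/
lemma eq_of_nonempty (h : IsOuterNormal K e n) (h' : IsOuterNormal K e n') (he : e.Nonempty) :
    n = n' := by
  obtain ⟨x, hx⟩ := he
  obtain ⟨ε, hε, hn⟩ := h.2 x hx
  obtain ⟨ε', hε', hn'⟩ := h'.2 x hx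
  by_contra hne
  have hlt : inner ℝ n n' < 1 := (inner_lt_one_iff_real_of_norm_eq_one h.1 h'.1).2 hne
  set δ := min ε ε' with hδ
  have hδ0 : 0 < δ := lt_min hε hε'
  have hnorm : ‖n' - n‖ ≤ 2 := by
    have := norm_sub_le n' n
    rw [h.1, h'.1] at this; linarith
  set z := x + (δ / 4) • (n' - n) with hz
  have hzx : z - x = (δ / 4) • (n' - n) := by simp [hz]
  have hdist : dist z x < δ := by
    rw [dist_eq_norm, hzx, norm_smul, Real.norm_of_nonneg (by positivity)]
    nlinarith
  have h1 : inner ℝ n (z - x) < 0 := by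
    rw [hzx, inner_smul_right, inner_sub_right, real_inner_self_eq_norm_sq, h.1]
    nlinarith
  have h2 : ¬ inner ℝ n' (z - x) < 0 := by
    rw [hzx, inner_smul_right, inner_sub_right, real_inner_self_eq_norm_sq, h'.1,
      real_inner_comm]
    nlinarith
  exact h2 ((hn' z (hdist.trans_le (min_le_right _ _))).1
    ((hn z (hdist.trans_le (min_le_left _ _))).2 h1))

/-- If n' ≠ -n, a small step along -(n + n') enters both K and K'. -/
lemma eq_neg_of_disjoint (h : IsOuterNormal K e n) (h' : IsOuterNormal K' e n')
    (he : e.Nonempty) (hKK' : Disjoint K K') : n' = -n := by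
  obtain ⟨x, hx⟩ := he
  obtain ⟨ε, hε, hn⟩ := h.2 x hx
  obtain ⟨ε', hε', hn'⟩ := h'.2 x hx
  by_contra hne
  have hlt : inner ℝ (-n) n' < 1 :=
    (inner_lt_one_iff_real_of_norm_eq_one (by rw [norm_neg, h.1]) h'.1).2 fun h => hne h.symm
  rw [inner_neg_left] at hlt
  set δ := min ε ε' with hδ
  have hδ0 : 0 < δ := lt_min hε hε'
  have hnorm : ‖n + n'‖ ≤ 2 := by
    have := norm_add_le n n'
    rw [h.1, h'.1] at this; linarith
  set z := x - (δ / 4) • (n + n') with hz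
  have hzx : z - x = -((δ / 4) • (n + n')) := by simp [hz]
  have hdist : dist z x < δ := by
    rw [dist_eq_norm, hzx, norm_neg, norm_smul, Real.norm_of_nonneg (by positivity)]
    nlinarith
  have h1 : inner ℝ n (z - x) < 0 := by
    rw [hzx, inner_neg_right, inner_smul_right, inner_add_right, real_inner_self_eq_norm_sq, h.1]
    nlinarith
  have h2 : inner ℝ n' (z - x) < 0 := by
    rw [hzx, inner_neg_right, inner_smul_right, inner_add_right, real_inner_self_eq_norm_sq, h'.1,
      real_inner_comm]
    nlinarith
  exact Set.disjoint_left.1 hKK' ((hn z (hdist.trans_le (min_le_left _ _))).2 h1)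
    ((hn' z (hdist.trans_le (min_le_right _ _))).2 h2)

end IsOuterNormal

namespace StarBall

variable {K e : Set (Pt d)} {c : Pt d} {r : ℝ} {A : AffineSubspace ℝ (Pt d)}

/-- A boundary face of a set that is star-shaped with respect to a ball has an outer normal, and
the ball lies on the inner side of the face. -/
lemma exists_outerNormal (hK : StarBall K c r) (he : FlatPiece A e) (heK : e ⊆ frontier K) :
    ∃ n : Pt d, IsOuterNormal K e n ∧ A.direction = (ℝ ∙ n)ᗮ ∧
      ∀ x ∈ A, r ≤ inner ℝ n (x - c) := by
  have key : ∃ n : Pt d, ‖n‖ = 1 ∧ A.direction = (ℝ ∙ n)ᗮ ∧ ∀ x ∈ A, 0 ≤ inner ℝ n (x - c) := by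
    obtain ⟨n, hn, hA⟩ := exists_unit_normal he.finrank
    obtain ⟨x₀, hx₀⟩ := he.nonempty
    have hx₀ : x₀ ∈ A := by
      obtain ⟨U, _, rfl⟩ := he.relOpen
      exact hx₀.2
    have hconst : ∀ x ∈ A, inner ℝ n (x - c) = inner ℝ n (x₀ - c) := fun x hx => by
      have := (mem_iff_inner_eq_zero hA hx₀).1 hx
      rw [← sub_add_sub_cancel x x₀ c, inner_add_right, this, zero_add]
    rcases le_total 0 (inner ℝ n (x₀ - c)) with h | h
    · exact ⟨n, hn, hA, fun x hx => (hconst x hx).symm ▸ h⟩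
    · refine ⟨-n, by rw [norm_neg, hn], ?_, fun x hx => ?_⟩
      · rw [hA, ← Set.neg_singleton, Submodule.span_neg]
      · rw [inner_neg_left, hconst x hx]; linarith
  obtain ⟨n, hn, hA, hpos⟩ := key
  have hr : ∀ x ∈ A, r ≤ inner ℝ n (x - c) := by
    intro x hx
    by_contra! hlt
    -- This point is the orthogonal projection of c onto A; if A were closer than r, it would be a
    -- star centre lying on A.
    refine hK.notMem_of_mem_ball he heK (y := c + (inner ℝ n (x - c)) • n) ?_ ?_
    · rw [Metric.mem_ball, dist_eq_norm, add_sub_cancel_left, norm_smul, hn, mul_one,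
        Real.norm_of_nonneg (hpos x hx)]
      exact hlt
    · rw [mem_iff_inner_eq_zero hA hx, add_sub_right_comm, inner_add_right, inner_smul_right,
        real_inner_self_eq_norm_sq, hn, ← neg_sub x c, inner_neg_right]
      ring
  refine ⟨n, ⟨hn, fun x hx => ?_⟩, hA, hr⟩
  obtain ⟨U, hU, rfl⟩ := he.relOpen
  set a := inner ℝ n (x - c) with ha
  have ha0 : 0 < a := hK.pos.trans_le (hr x hx.2)
  have hcontn : ContinuousAt (fun z : Pt d => inner ℝ n (z - c)) x := by fun_prop
  have hcont : ContinuousAt (fun z : Pt d => c + (a / inner ℝ n (z - c)) • (z - c)) x := by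
    exact continuousAt_const.add ((continuousAt_const.div hcontn ha0.ne').smul
      (continuousAt_id.sub continuousAt_const))
  have hev : ∀ᶠ z in nhds x, c + (a / inner ℝ n (z - c)) • (z - c) ∈ U := by
    refine hcont.eventually (hU.mem_nhds ?_)
    simp only [← ha, div_self ha0.ne']
    simpa using hx.1
  have hev2 : ∀ᶠ z in nhds x, 0 < inner ℝ n (z - c) := hcontn.eventually (lt_mem_nhds ha0)
  obtain ⟨ε, hε, hball⟩ := Metric.eventually_nhds_iff_ball.1 (hev.and hev2)
  refine ⟨ε, hε, fun z hz => ?_⟩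
  obtain ⟨hzU, hzpos⟩ := hball z hz
  set b := inner ℝ n (z - c) with hb
  have hzx : inner ℝ n (z - x) = b - a := by
    rw [hb, ha, ← inner_sub_right, sub_sub_sub_cancel_right]
  -- Here p is where the ray from c through z crosses A. For z near x it lies in e, hence on the
  -- frontier, so z is in K exactly when it comes before p, that is when b < a.
  set p := c + (a / b) • (z - c) with hp
  have hpA : p ∈ A := by
    rw [mem_iff_inner_eq_zero hA hx.2, hp, add_sub_right_comm, inner_add_right, inner_smul_right,
      ← hb, ← neg_sub x c, inner_neg_right, ← ha, div_mul_cancel₀ _ hzpos.ne']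
    ring
  have hpF : p ∈ frontier K := heK ⟨hzU, hpA⟩
  have hc : c ∈ Metric.ball c r := Metric.mem_ball_self hK.pos
  rw [hzx]
  constructor
  · intro hzK
    by_contra! hab
    refine hK.disjoint_frontier hpF ?_
    have hdiv : a / b ≤ 1 := (div_le_one hzpos).2 (by linarith)
    have := (hK.star c hc) hzK (sub_nonneg.2 hdiv) (div_nonneg ha0.le hzpos.le) (by ring)
    convert this using 1
    rw [hp]; module
  · intro hab
    have := hK.mem_of_mem_closure (frontier_subset_closure hpF) hc (t := b / a)
      (div_nonneg hzpos.le ha0.le) ((div_lt_one ha0).2 (by linarith))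
    convert this using 1
    rw [hp, add_sub_cancel_left, smul_smul, div_mul_div_cancel₀ ha0.ne', div_self hzpos.ne']
    simp

lemma outerNormal_spec (hK : StarBall K c r) (he : FlatPiece A e) (heK : e ⊆ frontier K) :
    IsOuterNormal K e (outerNormal K e) ∧ A.direction = (ℝ ∙ outerNormal K e)ᗮ ∧
      ∀ x ∈ A, r ≤ inner ℝ (outerNormal K e) (x - c) := by
  obtain ⟨n, hn, h⟩ := hK.exists_outerNormal he heK
  have h' : IsOuterNormal K e (outerNormal K e) := Classical.epsilon_spec ⟨n, hn⟩
  rw [← hn.eq_of_nonempty h' he.nonempty]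
  exact ⟨hn, h⟩

end StarBall

end HDG

namespace HDG

variable {d : ℕ}

/-! ### Cones over flat pieces -/

namespace FlatPiece

variable {e : Set (Pt d)} {A : AffineSubspace ℝ (Pt d)}

lemma subset (he : FlatPiece A e) : e ⊆ A := by
  obtain ⟨U, _, rfl⟩ := he.relOpen
  exact Set.inter_subset_right

lemma measurableSet (he : FlatPiece A e) : MeasurableSet e := by
  obtain ⟨U, hU, rfl⟩ := he.relOpen
  exact hU.measurableSet.inter (AffineSubspace.closed_of_finiteDimensional A).measurableSet

/-- The hyperplane is an isometric copy of its direction space, where the Hausdorff measure is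
Lebesgue measure and bounded sets have finite volume. -/
lemma measure_ne_top (he : FlatPiece A e) : (μHE[d - 1] : Measure (Pt d)) e ≠ ⊤ := by
  obtain ⟨x, hx⟩ := he.nonempty
  have hiso : Isometry fun v : A.direction => (v : Pt d) + x := fun v w => by
    simp [Subtype.edist_eq]
  have hfr : d - 1 = Module.finrank ℝ A.direction := by have := he.finrank; omega
  have himg : e = (fun v : A.direction => (v : Pt d) + x) ''
      ((fun v : A.direction => (v : Pt d) + x) ⁻¹' e) := by
    refine (Set.image_preimage_eq_of_subset fun z hz => ?_).symm
    refine ⟨⟨z - x, ?_⟩, by simp⟩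
    have := AffineSubspace.vsub_mem_direction (he.subset hz) (he.subset hx)
    simpa using this
  rw [himg, hiso.euclideanHausdorffMeasure_image, hfr,
    InnerProductSpace.euclideanHausdorffMeasure_eq_volume]
  refine (Bornology.IsBounded.measure_lt_top ?_).ne
  exact hiso.antilipschitz.isBounded_preimage he.bounded

lemma isFiniteMeasure_surf (he : FlatPiece A e) : IsFiniteMeasure (surf e) :=
  ⟨by simpa [surf] using he.measure_ne_top.lt_top⟩

lemma integrable_surf (he : FlatPiece A e) {g : Pt d → ℝ} (hg : Continuous g) :
    Integrable g (surf e) :=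
  integrable_of_bounded he.bounded he.measure_ne_top he.measurableSet hg

end FlatPiece

/-- The open cone over `e` with apex `y`. -/
def cone (y : Pt d) (e : Set (Pt d)) : Set (Pt d) :=
  {z | ∃ s ∈ Set.Ioo (0 : ℝ) 1, ∃ x ∈ e, y + s • (x - y) = z}

section Cone

variable {e : Set (Pt d)} {A : AffineSubspace ℝ (Pt d)} {n y : Pt d} {D : ℝ}

/-- Describes the cone by the height of z and its radial projection onto the base; this form makes
measurability evident. -/
lemma cone_eq {U : Set (Pt d)} (he : e = U ∩ A) (hA : A.direction = (ℝ ∙ n)ᗮ) (hne : e.Nonempty)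
    (hD : 0 < D) (hy : ∀ x ∈ A, inner ℝ n (x - y) = D) :
    cone y e = {z | 0 < inner ℝ n (z - y) ∧ inner ℝ n (z - y) < D ∧
      y + (D / inner ℝ n (z - y)) • (z - y) ∈ U} := by
  ext z
  constructor
  · rintro ⟨s, ⟨hs0, hs1⟩, x, hx, rfl⟩
    have hx' := hx
    rw [he] at hx'
    have hi : inner ℝ n (y + s • (x - y) - y) = s * D := by
      rw [add_sub_cancel_left, inner_smul_right, hy x hx'.2]
    simp only [Set.mem_ofPred_eq]
    rw [hi, add_sub_cancel_left, smul_smul, div_mul_eq_div_div_swap, div_self hD.ne',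
      one_div_mul_cancel hs0.ne', one_smul, add_sub_cancel]
    exact ⟨by positivity, by nlinarith, hx'.1⟩
  · rintro ⟨h0, h1, hU⟩
    refine ⟨inner ℝ n (z - y) / D, ⟨by positivity, (div_lt_one hD).2 h1⟩,
      y + (D / inner ℝ n (z - y)) • (z - y), ?_, ?_⟩
    · rw [he]
      refine ⟨hU, ?_⟩
      obtain ⟨x, hx⟩ := hne
      rw [he] at hx
      rw [SetLike.mem_coe, mem_iff_inner_eq_zero hA hx.2, add_sub_right_comm, inner_add_right,
        inner_smul_right, div_mul_cancel₀ _ h0.ne', ← neg_sub x y, inner_neg_right, hy x hx.2]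
      ring
    · rw [add_sub_cancel_left, smul_smul, div_mul_div_cancel₀ hD.ne', div_self h0.ne', one_smul,
        add_sub_cancel]

lemma measurableSet_cone (he : FlatPiece A e) (hA : A.direction = (ℝ ∙ n)ᗮ)
    (hD : 0 < D) (hy : ∀ x ∈ A, inner ℝ n (x - y) = D) : MeasurableSet (cone y e) := by
  obtain ⟨U, hU, heU⟩ := he.relOpen
  rw [cone_eq heU hA he.nonempty hD hy]
  have h1 : Measurable fun z : Pt d => inner ℝ n (z - y) := by fun_prop
  have h2 : Measurable fun z : Pt d => y + (D / inner ℝ n (z - y)) • (z - y) := by fun_prop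
  exact (measurableSet_lt measurable_const h1).inter
    ((measurableSet_lt h1 measurable_const).inter (h2 hU.measurableSet))

/-- The measure of a part of a cone, by slicing it parallel to its base. -/
lemma volume_cone_inter (he : FlatPiece A e) (hn : ‖n‖ = 1) (hA : A.direction = (ℝ ∙ n)ᗮ)
    (hD : 0 < D) (hy : ∀ x ∈ A, inner ℝ n (x - y) = D) {t : Set (Pt d)} (ht : MeasurableSet t) :
    volume (t ∩ cone y e) = ∫⁻ s in Set.Ioo (0 : ℝ) 1,
      ENNReal.ofReal (D * s ^ (d - 1)) * surf e ((fun x => y + s • (x - y)) ⁻¹' t) := by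
  -- Slicing along D•n makes the parameter s the relative height, at the price of the factor D.
  have hv : D • n ≠ 0 := smul_ne_zero hD.ne' (norm_ne_zero_iff.1 (by rw [hn]; exact one_ne_zero))
  rw [← InnerProductSpace.euclideanHausdorffMeasure_eq_volume,
    EuclideanGeometry.euclideanHausdorffMeasure_eq_lintegral y hv
      (ht.inter (measurableSet_cone he hA hD hy)), finrank_euclideanSpace_fin]
  have hnorm : ‖D • n‖ₑ = ENNReal.ofReal D := by
    rw [← ofReal_norm, norm_smul, hn, mul_one, Real.norm_of_nonneg hD.le]
  rw [hnorm, ← lintegral_const_mul' _ _ ENNReal.ofReal_ne_top,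
    ← lintegral_indicator measurableSet_Ioo]
  refine lintegral_congr fun s => ?_
  have hmem : ∀ z : Pt d, z ∈ AffineSubspace.mk' (s • D • n +ᵥ y) (ℝ ∙ (D • n))ᗮ ↔
      inner ℝ n (z - y) = s * D := fun z => by
    rw [AffineSubspace.mem_mk', Submodule.mem_orthogonal_singleton_iff_inner_right, vsub_eq_sub,
      vadd_eq_add, inner_smul_left, sub_add_eq_sub_sub_swap, inner_sub_right, smul_smul,
      inner_smul_right, real_inner_self_eq_norm_sq, hn]
    simp [hD.ne', sub_eq_zero]
  have hslice : ∀ z ∈ cone y e, ∃ s ∈ Set.Ioo (0 : ℝ) 1, ∃ x ∈ e, y + s • (x - y) = z ∧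
      inner ℝ n (z - y) = s * D := by
    rintro z ⟨s', hs', x, hx, rfl⟩
    refine ⟨s', hs', x, hx, rfl, ?_⟩
    rw [add_sub_cancel_left, inner_smul_right, hy x (he.subset hx)]
  -- For 0 < s < 1 the slice is the base shrunk towards y by s, which scales its (d-1)-measure by
  -- s^(d-1). Other slices are empty.
  by_cases hs : s ∈ Set.Ioo (0 : ℝ) 1
  · rw [Set.indicator_of_mem hs]
    have hset : t ∩ cone y e ∩ AffineSubspace.mk' (s • D • n +ᵥ y) (ℝ ∙ (D • n))ᗮ =
        AffineMap.homothety y s '' (((fun x => y + s • (x - y)) ⁻¹' t) ∩ e) := by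
      ext z
      simp only [Set.mem_inter_iff, SetLike.mem_coe, hmem]
      simp only [Set.mem_image, Set.mem_inter_iff, Set.mem_preimage,
        AffineMap.homothety_apply, vsub_eq_sub, vadd_eq_add]
      constructor
      · rintro ⟨⟨hzt, hzc⟩, hz⟩
        obtain ⟨s', _, x, hx, rfl, hi⟩ := hslice z hzc
        have : s' = s := mul_right_cancel₀ hD.ne' (hi.symm.trans hz)
        subst this
        exact ⟨x, ⟨hzt, hx⟩, add_comm _ _⟩
      · rintro ⟨x, ⟨hxt, hx⟩, rfl⟩
        rw [add_comm]
        refine ⟨⟨hxt, s, hs, x, hx, rfl⟩, ?_⟩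
        rw [add_sub_cancel_left, inner_smul_right, hy x (he.subset hx)]
    have hmap : Measurable fun x : Pt d => y + s • (x - y) := by fun_prop
    rw [hset, MeasureTheory.euclideanHausdorffMeasure_homothety_image _ _ hs.1.ne', surf,
      Measure.restrict_apply (hmap ht), ENNReal.ofReal_mul hD.le, mul_assoc, ENNReal.smul_def,
      smul_eq_mul]
    congr 2
    rw [ENNReal.ofReal_pow hs.1.le, ENNReal.coe_pow, ← enorm_eq_nnnorm,
      Real.enorm_of_nonneg hs.1.le]
  · rw [Set.indicator_of_notMem hs]
    have hset : t ∩ cone y e ∩ AffineSubspace.mk' (s • D • n +ᵥ y) (ℝ ∙ (D • n))ᗮ = ∅ := by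
      refine Set.eq_empty_of_forall_notMem fun z hz => hs ?_
      obtain ⟨s', hs', x, hx, _, hi⟩ := hslice z hz.1.2
      have : s' = s := mul_right_cancel₀ hD.ne' (hi.symm.trans ((hmem z).1 hz.2))
      exact this ▸ hs'
    rw [hset]
    simp

/-- Integration over a cone in polar coordinates around its apex. -/
lemma integral_cone (he : FlatPiece A e) (hn : ‖n‖ = 1) (hA : A.direction = (ℝ ∙ n)ᗮ)
    (hD : 0 < D) (hy : ∀ x ∈ A, inner ℝ n (x - y) = D) {F : Pt d → ℝ}
    (hF : IntegrableOn F (cone y e)) (hFc : Continuous F) :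
    ∫ z in cone y e, F z =
      ∫ x, (∫ s in Set.Ioo (0 : ℝ) 1, D * s ^ (d - 1) * F (y + s • (x - y))) ∂(surf e) := by
  have := he.isFiniteMeasure_surf
  set ρ : ℝ → NNReal := fun s => (D * s ^ (d - 1)).toNNReal with hρ
  have hρm : Measurable ρ := by fun_prop
  set ν : Measure ℝ := (volume.restrict (Set.Ioo (0 : ℝ) 1)).withDensity fun s => ρ s with hν
  set φ : ℝ × Pt d → Pt d := fun p => y + p.1 • (p.2 - y) with hφ
  have hφm : Measurable φ := by fun_prop
  -- Polar coordinates as an identity of measures: Lebesgue measure on the cone is the image of D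
  -- s^(d-1) ds ⊗ surface measure.
  have hmap : volume.restrict (cone y e) = (ν.prod (surf e)).map φ := by
    ext t ht
    rw [Measure.restrict_apply ht, volume_cone_inter he hn hA hD hy ht,
      Measure.map_apply hφm ht, Measure.prod_apply (hφm ht), hν,
      lintegral_withDensity_eq_lintegral_mul _ (by fun_prop)
        (measurable_measure_prodMk_left (hφm ht))]
    rfl
  have hint : Integrable (fun p => F (φ p)) (ν.prod (surf e)) := by
    rw [IntegrableOn, hmap] at hF
    exact (integrable_map_measure hFc.aestronglyMeasurable hφm.aemeasurable).1 hF
  rw [hmap, integral_map hφm.aemeasurable hFc.aestronglyMeasurable, integral_prod_symm _ hint]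
  refine integral_congr_ae (Filter.Eventually.of_forall fun x => ?_)
  simp only [hν]
  rw [integral_withDensity_eq_integral_smul hρm]
  refine setIntegral_congr_fun measurableSet_Ioo fun s hs => ?_
  have : 0 ≤ D * s ^ (d - 1) := mul_nonneg hD.le (pow_nonneg hs.1.le _)
  simp [hρ, hφ, NNReal.smul_def, Real.coe_toNNReal _ this]

/-- The divergence theorem on a cone for the field `(x - y) g`, which is tangential to the lateral
boundary. -/
lemma integral_cone_radial (he : FlatPiece A e) (hn : ‖n‖ = 1) (hA : A.direction = (ℝ ∙ n)ᗮ)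
    (hD : 0 < D) (hy : ∀ x ∈ A, inner ℝ n (x - y) = D) (g : MvPolynomial (Fin d) ℝ)
    (hint : IntegrableOn (fun x => d * val g x + inner ℝ (x - y) (grad g x)) (cone y e)) :
    ∫ x in cone y e, (d * val g x + inner ℝ (x - y) (grad g x)) = D * ∫ x, val g x ∂(surf e) := by
  have hd : 1 ≤ d := by have := he.finrank; omega
  rw [integral_cone he hn hA hD hy hint (by fun_prop), ← integral_const_mul]
  refine integral_congr_ae (Filter.Eventually.of_forall fun x => ?_)
  simp only
  -- Along each ray the weighted integrand is the derivative of D s^d g, which is zero at the apex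
  -- and D g(x) on the base.
  have hderiv : ∀ s ∈ Set.uIcc (0 : ℝ) 1,
      HasDerivAt (fun s => D * (s ^ d * val g (y + s • (x - y))))
      (D * s ^ (d - 1) * (d * val g (y + s • (x - y)) +
        inner ℝ (y + s • (x - y) - y) (grad g (y + s • (x - y))))) s := fun s _ => by
    refine (((hasDerivAt_pow d s).mul
      (hasDerivAt_val_line g y (x - y) s)).const_mul D).congr_deriv ?_
    rw [add_sub_cancel_left, inner_smul_left]
    obtain ⟨m, rfl⟩ : ∃ m, d = m + 1 := ⟨d - 1, by omega⟩
    simp only [Nat.add_sub_cancel, pow_succ, conj_trivial]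
    ring
  have hcont : Continuous fun s : ℝ => D * s ^ (d - 1) * (d * val g (y + s • (x - y)) +
        inner ℝ (y + s • (x - y) - y) (grad g (y + s • (x - y)))) := by fun_prop
  have := intervalIntegral.integral_eq_sub_of_hasDerivAt hderiv (hcont.intervalIntegrable _ _)
  rw [intervalIntegral.integral_of_le zero_le_one, integral_Ioc_eq_integral_Ioo] at this
  rw [this]
  simp [show d ≠ 0 by omega]

end Cone

end HDG

namespace HDG

variable {d : ℕ}

/-! ### The divergence theorem on star-shaped polytopes -/

/-- A set that is star-shaped with respect to a ball, whose boundary is covered by the closures of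
finitely many disjoint flat pieces. -/
structure StarPolytope (K : Set (Pt d)) (F : Finset (Set (Pt d))) (c : Pt d) (r : ℝ) : Prop
    extends StarBall K c r where
  flat : ∀ e ∈ F, ∃ A : AffineSubspace ℝ (Pt d), FlatPiece A e ∧
    ∃ B : Set (AffineSubspace ℝ (Pt d)), B.Finite ∧
      (∀ b ∈ B, Module.finrank ℝ b.direction + 1 = Module.finrank ℝ A.direction) ∧
      closure e \ e ⊆ ⋃ b ∈ B, (b : Set (Pt d))
  subset_frontier : ∀ e ∈ F, e ⊆ frontier K
  disjoint : ∀ e ∈ F, ∀ e' ∈ F, e ≠ e' → Disjoint e e'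
  frontier_subset : frontier K ⊆ ⋃ e ∈ F, closure e

namespace StarBall

variable {K : Set (Pt d)} {c y : Pt d} {r : ℝ}

/-- A ray from a star centre meets the boundary at most once. -/
lemma eq_of_ray (hK : StarBall K c r) (hy : y ∈ Metric.ball c r) {x x' : Pt d}
    (hx : x ∈ frontier K) (hx' : x' ∈ frontier K) {s s' : ℝ} (hs : 0 < s) (hs' : 0 < s')
    (h : y + s • (x - y) = y + s' • (x' - y)) : x = x' := by
  -- If s < s', then x' lies strictly between y and x, hence inside K.
  have aux : ∀ {x x' : Pt d} {s s' : ℝ}, x ∈ frontier K → x' ∈ frontier K → 0 < s → 0 < s' →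
      y + s • (x - y) = y + s' • (x' - y) → ¬ s < s' := by
    intro x x' s s' hx hx' hs hs' h hlt
    refine hK.disjoint_frontier hx' ?_
    have := hK.mem_of_mem_closure (frontier_subset_closure hx) hy (t := s / s') (by positivity)
      ((div_lt_one hs').2 hlt)
    have h' : x' - y = (s / s') • (x - y) := by
      rw [div_eq_inv_mul, mul_smul, add_left_cancel h, smul_smul, inv_mul_cancel₀ hs'.ne', one_smul]
    rwa [← h', add_sub_cancel] at this
  obtain rfl : s = s' := le_antisymm (not_lt.1 (aux hx' hx hs' hs h.symm))
    (not_lt.1 (aux hx hx' hs hs' h))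
  have := smul_right_injective _ hs.ne' (add_left_cancel h)
  simpa using this

lemma cone_subset (hK : StarBall K c r) (hy : y ∈ Metric.ball c r) {e : Set (Pt d)}
    (he : e ⊆ frontier K) : cone y e ⊆ K := by
  rintro z ⟨s, hs, x, hx, rfl⟩
  exact hK.mem_of_mem_closure (frontier_subset_closure (he hx)) hy hs.1.le hs.2

/-- A star centre has a positive height below the hyperplane of every boundary face. -/
lemma exists_height (hK : StarBall K c r) {e : Set (Pt d)} {A : AffineSubspace ℝ (Pt d)}
    (he : FlatPiece A e) (heK : e ⊆ frontier K) (hy : y ∈ Metric.ball c r) :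
    ∃ D > 0, ∀ x ∈ A, inner ℝ (outerNormal K e) (x - y) = D := by
  obtain ⟨hn, hA, hr⟩ := hK.outerNormal_spec he heK
  obtain ⟨x₀, hx₀⟩ := he.nonempty
  refine ⟨inner ℝ (outerNormal K e) (x₀ - y), ?_, fun x hx => ?_⟩
  · have h1 := hr x₀ (he.subset hx₀)
    have h2 := real_inner_le_norm (outerNormal K e) (y - c)
    rw [hn.1, one_mul] at h2
    have h3 : ‖y - c‖ < r := by rwa [← dist_eq_norm]
    rw [← sub_sub_sub_cancel_right x₀ y c, inner_sub_right]
    linarith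
  · have := (mem_iff_inner_eq_zero hA (he.subset hx₀)).1 hx
    rw [← sub_add_sub_cancel x x₀ y, inner_add_right, this, zero_add]

/-- Every ray from a point of `K` through another point of `K` meets the boundary behind it. -/
lemma exists_mem_frontier (hK : StarBall K c r) {x : Pt d} (hx : x ∈ K) (hxy : x ≠ y) :
    ∃ s : ℝ, 1 < s ∧ y + s • (x - y) ∈ frontier K := by
  have hcont : Continuous fun s : ℝ => y + s • (x - y) := by fun_prop
  have hpre : IsPreconnected ((fun s : ℝ => y + s • (x - y)) '' Set.Ici 1) :=
    isPreconnected_Ici.image _ hcont.continuousOn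
  obtain ⟨R, hR⟩ := hK.bounded.exists_norm_le
  have hpos : 0 < ‖x - y‖ := norm_pos_iff.2 (sub_ne_zero.2 hxy)
  have hR0 : 0 ≤ R := (norm_nonneg _).trans (hR x hx)
  by_contra! hcon
  -- Without a crossing, the connected half-line from x onwards would stay in K, against
  -- boundedness.
  have hsub := hpre.subset_of_closure_inter_subset hK.isOpen ⟨x, ⟨1, by simp, by simp⟩, hx⟩ (by
    rintro _ ⟨hz, s, hs, rfl⟩
    rcases (Set.mem_Ici.1 hs).eq_or_lt with rfl | hs'
    · simpa using hx
    · by_contra hzK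
      exact hcon s hs' (hK.isOpen.frontier_eq ▸ ⟨hz, hzK⟩))
  have hmem := hsub ⟨1 + (R + ‖y‖ + 1) / ‖x - y‖, by
    have : 0 ≤ (R + ‖y‖ + 1) / ‖x - y‖ := by positivity
    simpa using this, rfl⟩
  have h1 := hR _ hmem
  have h2 := norm_sub_norm_le ((1 + (R + ‖y‖ + 1) / ‖x - y‖) • (x - y)) (-y)
  rw [sub_neg_eq_add, add_comm _ y, norm_neg, norm_smul, Real.norm_of_nonneg (by positivity),
    add_mul, div_mul_cancel₀ _ hpos.ne'] at h2
  linarith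

end StarBall

namespace StarPolytope

variable {K : Set (Pt d)} {F : Finset (Set (Pt d))} {c y : Pt d} {r : ℝ}

/-- A point of K other than y that is in no open cone lies on a ray that hits the frontier in the
relative boundary of some face. That boundary is covered by finitely many subspaces of codimension
two, whose spans with y are null sets. -/
lemma volume_diff_cones (hd : 0 < d) (hK : StarPolytope K F c r) (y : Pt d) :
    volume (K \ ⋃ e ∈ F, cone y e) = 0 := by
  have hnt : Nontrivial (Pt d) := Module.nontrivial_of_finrank_pos (R := ℝ) (by simpa using hd)
  choose! A hA B hBf hBd hB using hK.flat
  have hsub : K \ ⋃ e ∈ F, cone y e ⊆ {y} ∪ ⋃ e ∈ F, ⋃ b ∈ B e,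
      (affineSpan ℝ (insert y (b : Set (Pt d))) : Set (Pt d)) := by
    rintro x ⟨hxK, hx⟩
    by_cases hxy : x = y
    · exact Or.inl hxy
    refine Or.inr ?_
    obtain ⟨s, hs, hsF⟩ := hK.exists_mem_frontier hxK hxy
    have hs0 : 0 < s := by linarith
    have hback : y + s⁻¹ • (y + s • (x - y) - y) = x := by
      rw [add_sub_cancel_left, smul_smul, inv_mul_cancel₀ hs0.ne', one_smul, add_sub_cancel]
    obtain ⟨e, he, hse⟩ := Set.mem_iUnion₂.1 (hK.frontier_subset hsF)
    have hnot : y + s • (x - y) ∉ e := fun hmem => hx <| Set.mem_iUnion₂.2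
      ⟨e, he, s⁻¹, ⟨inv_pos.2 hs0, inv_lt_one_of_one_lt₀ hs⟩, _, hmem, hback⟩
    obtain ⟨b, hb, hsb⟩ := Set.mem_iUnion₂.1 (hB e he ⟨hse, hnot⟩)
    refine Set.mem_iUnion₂.2 ⟨e, he, Set.mem_iUnion₂.2 ⟨b, hb, ?_⟩⟩
    have h1 : y ∈ affineSpan ℝ (insert y (b : Set (Pt d))) :=
      subset_affineSpan ℝ _ (Set.mem_insert _ _)
    have h2 : y + s • (x - y) ∈ affineSpan ℝ (insert y (b : Set (Pt d))) :=
      subset_affineSpan ℝ _ (Set.mem_insert_of_mem _ hsb)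
    have := AffineMap.lineMap_mem s⁻¹ h1 h2
    rwa [AffineMap.lineMap_apply, vsub_eq_sub, vadd_eq_add, add_comm, hback] at this
  refine measure_mono_null hsub (measure_union_null (measure_singleton y) ?_)
  refine (measure_biUnion_null_iff F.countable_toSet).2 fun e he => ?_
  refine (measure_biUnion_null_iff (hBf e he).countable).2 fun b hb => ?_
  refine Measure.addHaar_affineSubspace _ _ fun htop => ?_
  have h1 := finrank_vectorSpan_insert_le b y
  have h2 := hBd e he b hb
  have h3 := (hA e he).finrank
  rw [← direction_affineSpan, htop, AffineSubspace.direction_top, finrank_top,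
    finrank_euclideanSpace_fin] at h1
  omega

/-- The cones are disjoint because the faces are and a ray from y meets the frontier only once; they
fill K up to a null set. -/
lemma integral_eq_sum_cones (hd : 0 < d) (hK : StarPolytope K F c r) (hy : y ∈ Metric.ball c r)
    {f : Pt d → ℝ} (hf : IntegrableOn f K) :
    ∫ x in K, f x = ∑ e ∈ F, ∫ x in cone y e, f x := by
  have hsub : ⋃ e ∈ F, cone y e ⊆ K :=
    Set.iUnion₂_subset fun e he => hK.cone_subset hy (hK.subset_frontier e he)
  have hae : K =ᵐ[volume] ⋃ e ∈ F, cone y e :=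
    (Filter.EventuallyLE.antisymm (LE.le.eventuallyLE hsub)
      (ae_le_set.2 (hK.volume_diff_cones hd y))).symm
  rw [setIntegral_congr_set hae, integral_biUnion_finset]
  · intro e he
    obtain ⟨A, hA, -⟩ := hK.flat e he
    obtain ⟨D, hD, hDy⟩ := hK.exists_height hA (hK.subset_frontier e he) hy
    exact measurableSet_cone hA (hK.outerNormal_spec hA (hK.subset_frontier e he)).2.1 hD hDy
  · intro e he e' he' hne
    refine Set.disjoint_left.2 ?_
    rintro z ⟨s, hs, x, hx, rfl⟩ ⟨s', hs', x', hx', h⟩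
    have := hK.eq_of_ray hy (hK.subset_frontier e' he' hx') (hK.subset_frontier e he hx) hs'.1
      hs.1 h
    exact Set.disjoint_left.1 (hK.disjoint e he e' he' hne) hx (this ▸ hx')
  · exact fun e he => hf.mono_set (hK.cone_subset hy (hK.subset_frontier e he))

lemma isFiniteMeasure_surf (hK : StarPolytope K F c r) {e : Set (Pt d)} (he : e ∈ F) :
    IsFiniteMeasure (surf e) := by
  obtain ⟨A, hA, -⟩ := hK.flat e he
  exact hA.isFiniteMeasure_surf

lemma integrable_surf (hK : StarPolytope K F c r) {e : Set (Pt d)} (he : e ∈ F) {g : Pt d → ℝ}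
    (hg : Continuous g) : Integrable g (surf e) := by
  obtain ⟨A, hA, -⟩ := hK.flat e he
  exact hA.integrable_surf hg

lemma ae_surf_mem (hK : StarPolytope K F c r) {e : Set (Pt d)} (he : e ∈ F) :
    ∀ᵐ x ∂(surf e), x ∈ e := by
  obtain ⟨A, hA, -⟩ := hK.flat e he
  exact ae_restrict_mem hA.measurableSet

lemma le_inner_outerNormal (hK : StarPolytope K F c r) {e : Set (Pt d)} (he : e ∈ F) {x : Pt d}
    (hx : x ∈ e) : r ≤ inner ℝ (outerNormal K e) (x - c) := by
  obtain ⟨A, hA, -⟩ := hK.flat e he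
  exact (hK.outerNormal_spec hA (hK.subset_frontier e he)).2.2 x (hA.subset hx)

lemma integrableOn (hK : StarPolytope K F c r) {g : Pt d → ℝ} (hg : Continuous g) :
    IntegrableOn g K :=
  integrable_of_bounded hK.bounded hK.bounded.measure_lt_top.ne hK.isOpen.measurableSet hg

/-- The divergence theorem for the field `(x - y) g`, where `y` is a star centre. -/
lemma integral_radial (hd : 0 < d) (hK : StarPolytope K F c r) (hy : y ∈ Metric.ball c r)
    (g : MvPolynomial (Fin d) ℝ) :
    ∫ x in K, (d * val g x + inner ℝ (x - y) (grad g x)) =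
      ∑ e ∈ F, ∫ x, val g x * inner ℝ (outerNormal K e) (x - y) ∂(surf e) := by
  have hint : IntegrableOn (fun x => d * val g x + inner ℝ (x - y) (grad g x)) K :=
    hK.integrableOn (by fun_prop)
  rw [hK.integral_eq_sum_cones hd hy hint]
  refine Finset.sum_congr rfl fun e he => ?_
  obtain ⟨A, hA, -⟩ := hK.flat e he
  have heK := hK.subset_frontier e he
  obtain ⟨D, hD, hDy⟩ := hK.exists_height hA heK hy
  obtain ⟨hn, hdir, -⟩ := hK.outerNormal_spec hA heK
  rw [integral_cone_radial hA hn.1 hdir hD hDy g (hint.mono_set (hK.cone_subset hy heK)),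
    ← integral_const_mul]
  refine integral_congr_ae ?_
  filter_upwards [hK.ae_surf_mem he] with x hx
  rw [hDy x (hA.subset hx), mul_comm]

/-- The divergence theorem for polynomials. -/
theorem integral_pderiv (hd : 0 < d) (hK : StarPolytope K F c r) (g : MvPolynomial (Fin d) ℝ)
    (i : Fin d) :
    ∫ x in K, val (MvPolynomial.pderiv i g) x =
      ∑ e ∈ F, ∫ x, val g x * outerNormal K e i ∂(surf e) := by
  have hr := hK.pos
  -- Two admissible apexes, c and c + v: the difference of the radial identities is the divergence
  -- theorem for the constant direction v.
  set v : Pt d := EuclideanSpace.single i (r / 2) with hv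
  have hc : c ∈ Metric.ball c r := Metric.mem_ball_self hr
  have hcv : c + v ∈ Metric.ball c r := by
    rw [Metric.mem_ball, dist_eq_norm, add_sub_cancel_left, hv, PiLp.norm_single,
      Real.norm_of_nonneg (by positivity)]
    linarith
  have h1 := hK.integral_radial hd hc g
  have h2 := hK.integral_radial hd hcv g
  have h3 := congrArg₂ (· - ·) h1 h2
  rw [← integral_sub (hK.integrableOn (by fun_prop)) (hK.integrableOn (by fun_prop)),
    ← Finset.sum_sub_distrib] at h3
  have h4 : ∀ x : Pt d, (d * val g x + inner ℝ (x - c) (grad g x)) -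
      (d * val g x + inner ℝ (x - (c + v)) (grad g x)) =
        r / 2 * val (MvPolynomial.pderiv i g) x := fun x => by
    rw [← sub_sub x c v, inner_sub_left (x - c), hv, EuclideanSpace.inner_single_left]
    simp
  have h5 : ∀ e ∈ F, (∫ x, val g x * inner ℝ (outerNormal K e) (x - c) ∂(surf e)) -
      ∫ x, val g x * inner ℝ (outerNormal K e) (x - (c + v)) ∂(surf e) =
        r / 2 * ∫ x, val g x * outerNormal K e i ∂(surf e) := fun e he => by
    rw [← integral_sub (hK.integrable_surf he (by fun_prop)) (hK.integrable_surf he (by fun_prop)),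
      ← integral_const_mul]
    refine integral_congr_ae (Filter.Eventually.of_forall fun x => ?_)
    simp only
    rw [← sub_sub x c v, inner_sub_right _ (x - c), hv, EuclideanSpace.inner_single_right]
    simp
    ring
  rw [Finset.sum_congr rfl h5, ← Finset.mul_sum] at h3
  simp only [h4] at h3
  rw [integral_const_mul] at h3
  exact mul_left_cancel₀ (by positivity) h3

end StarPolytope

end HDG

namespace HDG

variable {d : ℕ}

/-! ### Norm equivalence on polynomials -/

/-- On a finite-dimensional space, a linear map is bounded with respect to a positive definite
bilinear form. -/
lemma exists_norm_sq_le_of_posDef {V E : Type*} [AddCommGroup V] [Module ℝ V]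
    [FiniteDimensional ℝ V] [NormedAddCommGroup E] [NormedSpace ℝ E]
    (Q : V →ₗ[ℝ] V →ₗ[ℝ] ℝ) (hQ : ∀ v, v ≠ 0 → 0 < Q v v) (N : V →ₗ[ℝ] E) :
    ∃ C > 0, ∀ v, ‖N v‖ ^ 2 ≤ C * Q v v := by
  set b := Module.finBasis ℝ V with hb
  set φ := b.equivFun.symm with hφ
  have hcont : Continuous fun a : Fin (Module.finrank ℝ V) → ℝ => Q (φ a) (φ a) := by
    simp only [hφ, Module.Basis.equivFun_symm_apply, map_sum, map_smul, LinearMap.sum_apply,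
      LinearMap.smul_apply, smul_eq_mul]
    fun_prop
  -- The minimum of the form on the unit sphere of coordinates; in dimension zero the sphere is
  -- empty and any κ works.
  obtain ⟨κ, hκ, hmin⟩ : ∃ κ > 0, ∀ a, ‖a‖ = 1 → κ ≤ Q (φ a) (φ a) := by
    rcases (Metric.sphere (0 : Fin (Module.finrank ℝ V) → ℝ) 1).eq_empty_or_nonempty with h | h
    · refine ⟨1, one_pos, fun a ha => ?_⟩
      have : a ∈ Metric.sphere (0 : Fin (Module.finrank ℝ V) → ℝ) 1 := by simpa using ha
      simp [h] at this
    · obtain ⟨a₀, ha₀, hmin⟩ := (isCompact_sphere _ _).exists_isMinOn h hcont.continuousOn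
      refine ⟨Q (φ a₀) (φ a₀), hQ _ fun h0 => ?_, fun a ha => hmin (by simpa using ha)⟩
      have : a₀ = 0 := by simpa using h0
      simp [this] at ha₀
  set T : (Fin (Module.finrank ℝ V) → ℝ) →L[ℝ] E :=
    LinearMap.toContinuousLinearMap (N ∘ₗ φ.toLinearMap) with hT
  refine ⟨(‖T‖ ^ 2 + 1) / κ, by positivity, fun v => ?_⟩
  obtain ⟨a, rfl⟩ := φ.surjective v
  have hTa : N (φ a) = T a := rfl
  rcases eq_or_ne a 0 with rfl | ha
  · simp
  have hna : 0 < ‖a‖ := norm_pos_iff.2 ha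
  have h1 : κ * ‖a‖ ^ 2 ≤ Q (φ a) (φ a) := by
    have := hmin (‖a‖⁻¹ • a) (norm_smul_inv_norm (𝕜 := ℝ) ha)
    simp only [map_smul, LinearMap.smul_apply, smul_eq_mul] at this
    calc κ * ‖a‖ ^ 2 ≤ (‖a‖⁻¹ * (‖a‖⁻¹ * Q (φ a) (φ a))) * ‖a‖ ^ 2 := by gcongr
      _ = Q (φ a) (φ a) := by field_simp
  have h2 := T.le_opNorm a
  rw [hTa]
  calc ‖T a‖ ^ 2 ≤ (‖T‖ * ‖a‖) ^ 2 := by gcongr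
    _ ≤ (‖T‖ ^ 2 + 1) / κ * (κ * ‖a‖ ^ 2) := by
      rw [mul_pow]; field_simp; nlinarith [sq_nonneg ‖a‖]
    _ ≤ _ := by gcongr

lemma integrableOn_ball {g : Pt d → ℝ} (hg : Continuous g) (c : Pt d) (r : ℝ) :
    IntegrableOn g (Metric.ball c r) :=
  integrable_of_bounded Metric.isBounded_ball Metric.isBounded_ball.measure_lt_top.ne
    measurableSet_ball hg

/-- A polynomial whose square has integral zero over a nonempty open set is zero. -/
lemma eq_zero_of_integral_sq_eq_zero {U : Set (Pt d)} (hU : IsOpen U) (hne : U.Nonempty)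
    {p : MvPolynomial (Fin d) ℝ} (hint : IntegrableOn (fun x => val p x ^ 2) U)
    (h : ∫ x in U, val p x ^ 2 = 0) : p = 0 := by
  refine eq_zero_of_val_eq_zero hU hne ?_
  have h0 := (integral_eq_zero_iff_of_nonneg (fun x => sq_nonneg (val p x)) hint).1 h
  have h1 := Measure.eqOn_open_of_ae_eq h0 hU (by fun_prop) continuousOn_const
  exact fun x hx => by simpa using h1 hx

/-- Norm equivalence on P_m between the L² norm on the small ball and the sup norm on the large one.
The radius 2 is chosen because an element of size h lies within 2h of each of its points. -/
lemma exists_sup_le_unit (m : ℕ) {θ : ℝ} (hθ : 0 < θ) :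
    ∃ C > 0, ∀ p ∈ Poly d m, ∀ x ∈ Metric.closedBall (0 : Pt d) 2,
      val p x ^ 2 ≤ C * ∫ z in Metric.ball (0 : Pt d) θ, val p z ^ 2 := by
  let Q : Poly d m →ₗ[ℝ] Poly d m →ₗ[ℝ] ℝ := LinearMap.mk₂ ℝ
    (fun p q => ∫ z in Metric.ball (0 : Pt d) θ, val p.1 z * val q.1 z)
    (fun p p' q => by
      simp only [Submodule.coe_add, val_add, add_mul]
      exact integral_add (integrableOn_ball (by fun_prop) _ _)
        (integrableOn_ball (by fun_prop) _ _))
    (fun a p q => by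
      simp only [Submodule.coe_smul, val_smul, mul_assoc, integral_const_mul, smul_eq_mul])
    (fun p q q' => by
      simp only [Submodule.coe_add, val_add, mul_add]
      exact integral_add (integrableOn_ball (by fun_prop) _ _)
        (integrableOn_ball (by fun_prop) _ _))
    (fun a p q => by
      simp only [Submodule.coe_smul, val_smul, mul_left_comm _ a, integral_const_mul, smul_eq_mul])
  let N : Poly d m →ₗ[ℝ] C(Metric.closedBall (0 : Pt d) 2, ℝ) :=
    { toFun := fun p => ⟨fun x => val p.1 x.1, by fun_prop⟩
      map_add' := fun p q => by ext x; simp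
      map_smul' := fun a p => by ext x; simp }
  have hQ : ∀ p, Q p p = ∫ z in Metric.ball (0 : Pt d) θ, val p.1 z ^ 2 := fun p => by
    simp [Q, sq]
  obtain ⟨C, hC, h⟩ := exists_norm_sq_le_of_posDef Q (fun p hp => by
    rw [hQ]
    refine lt_of_le_of_ne (integral_nonneg fun x => sq_nonneg _) fun h0 => hp ?_
    exact Subtype.ext (eq_zero_of_integral_sq_eq_zero Metric.isOpen_ball (by simpa using hθ)
      (integrableOn_ball (by fun_prop) _ _) h0.symm)) N
  refine ⟨C, hC, fun p hp x hx => ?_⟩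
  have h1 := h ⟨p, hp⟩
  rw [hQ] at h1
  refine le_trans ?_ h1
  have := (N ⟨p, hp⟩).norm_coe_le_norm ⟨x, hx⟩
  rw [← sq_abs]
  exact pow_le_pow_left₀ (abs_nonneg _) this 2

lemma integral_ball_rescale {g : Pt d → ℝ} (c : Pt d) {h θ : ℝ} (hh : 0 < h) :
    ∫ x in Metric.ball (0 : Pt d) θ, g (c + h • x) =
      (h ^ d)⁻¹ * ∫ x in Metric.ball c (θ * h), g x := by
  have h1 := Measure.setIntegral_comp_smul_of_pos volume (fun x => g (c + x))
    (Metric.ball (0 : Pt d) θ) hh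
  rw [h1, finrank_euclideanSpace_fin, smul_eq_mul, smul_ball hh.ne', smul_zero,
    Real.norm_of_nonneg hh.le]
  congr 1
  have h2 := (measurePreserving_add_left volume c).setIntegral_preimage_emb
    (measurableEmbedding_addLeft c) g (Metric.ball c (θ * h))
  rw [← h2]
  simp [mul_comm h]

/-- Pointwise bound of polynomials by their `L²` norm on a smaller ball. -/
lemma exists_sup_le (m : ℕ) {θ : ℝ} (hθ : 0 < θ) :
    ∃ C > 0, ∀ p ∈ Poly d m, ∀ (c : Pt d) (h : ℝ), 0 < h → ∀ x ∈ Metric.closedBall c (2 * h),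
      val p x ^ 2 ≤ C * ((h ^ d)⁻¹ * ∫ z in Metric.ball c (θ * h), val p z ^ 2) := by
  obtain ⟨C, hC, hsup⟩ := exists_sup_le_unit (d := d) m hθ
  refine ⟨C, hC, fun p hp c h hh x hx => ?_⟩
  have h1 := hsup _ (rescale_mem_poly c h hp) (h⁻¹ • (x - c)) (by
    rw [mem_closedBall_zero_iff, norm_smul, norm_inv, Real.norm_of_nonneg hh.le, inv_mul_le_iff₀ hh,
      mul_comm h, ← dist_eq_norm]
    exact hx)
  simp only [val_rescale, smul_smul, mul_inv_cancel₀ hh.ne', one_smul, add_sub_cancel] at h1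
  rwa [integral_ball_rescale (g := fun x => val p x ^ 2) c hh] at h1

lemma norm_grad_sq (p : MvPolynomial (Fin d) ℝ) (x : Pt d) :
    ‖grad p x‖ ^ 2 = ∑ i, val (MvPolynomial.pderiv i p) x ^ 2 := by
  simp [EuclideanSpace.norm_sq_eq]

/-! ### Surface area and trace inequalities -/

namespace StarPolytope

variable {K : Set (Pt d)} {F : Finset (Set (Pt d))} {c : Pt d} {r h : ℝ}

/-- The surface area of a star-shaped polytope, in terms of its diameter. -/
lemma surface_le (hd : 0 < d) (hK : StarPolytope K F c r) (hh : 0 < h)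
    (hsub : K ⊆ Metric.closedBall c (2 * h)) :
    r * ∑ e ∈ F, (surf e).real Set.univ ≤
      d * (volume (Metric.closedBall (0 : Pt d) 2)).toReal * h ^ d := by
  -- With g = 1 the identity reads d|K| = ∑ₑ ∫ₑ n·(x - c), and n·(x - c) ≥ r on every face.
  have h1 := hK.integral_radial hd (Metric.mem_ball_self hK.pos) 1
  have hg : ∀ x : Pt d, grad (1 : MvPolynomial (Fin d) ℝ) x = 0 := fun x => by ext i; simp
  simp only [val_one, hg, inner_zero_right, add_zero, mul_one, one_mul] at h1
  have h2 : r * ∑ e ∈ F, (surf e).real Set.univ ≤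
      ∑ e ∈ F, ∫ x, inner ℝ (outerNormal K e) (x - c) ∂(surf e) := by
    rw [Finset.mul_sum]
    refine Finset.sum_le_sum fun e he => ?_
    have := hK.isFiniteMeasure_surf he
    calc r * (surf e).real Set.univ = ∫ _, r ∂(surf e) := by simp [mul_comm]
      _ ≤ _ := by
        refine integral_mono_ae (integrable_const r) (hK.integrable_surf he (by fun_prop)) ?_
        filter_upwards [hK.ae_surf_mem he] with x hx using hK.le_inner_outerNormal he hx
  refine h2.trans (h1.symm.le.trans ?_)
  rw [setIntegral_const, smul_eq_mul, mul_comm, mul_assoc]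
  refine mul_le_mul_of_nonneg_left ?_ (Nat.cast_nonneg d)
  have h3 : volume (Metric.closedBall c (2 * h)) =
      ENNReal.ofReal (h ^ d) * volume (Metric.closedBall (0 : Pt d) 2) := by
    rw [mul_comm, Measure.addHaar_closedBall_mul _ c hh.le zero_le_two, finrank_euclideanSpace_fin]
  have h4 := ENNReal.toReal_mono (Metric.isBounded_closedBall.measure_lt_top.ne)
    (measure_mono (μ := volume) hsub)
  rw [h3, ENNReal.toReal_mul, ENNReal.toReal_ofReal (by positivity), mul_comm] at h4
  exact h4

end StarPolytope

/-- The discrete trace inequality and an estimate of the oscillation of a polynomial on the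
boundary. -/
theorem exists_trace_const (hd : 0 < d) (m : ℕ) {θ : ℝ} (hθ : 0 < θ) :
    ∃ C > 0, ∀ (K : Set (Pt d)) (F : Finset (Set (Pt d))) (c : Pt d) (h : ℝ), 0 < h →
      StarPolytope K F c (θ * h) → K ⊆ Metric.closedBall c (2 * h) → ∀ p ∈ Poly d m,
        h * ∑ e ∈ F, ∫ x, val p x ^ 2 ∂(surf e) ≤ C * ∫ x in K, val p x ^ 2 ∧
        ∑ e ∈ F, ∫ x, (val p x - val p c) ^ 2 ∂(surf e) ≤
          C * (h * ∫ x in K, ‖grad p x‖ ^ 2) := by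
  obtain ⟨C, hC, hsup⟩ := exists_sup_le (d := d) m hθ
  set V := (volume (Metric.closedBall (0 : Pt d) 2)).toReal with hV
  have hV0 : 0 ≤ V := ENNReal.toReal_nonneg
  -- The factor 4 comes from squaring the distance bound 2h in the oscillation estimate; the 1 only
  -- ensures positivity.
  refine ⟨4 * (C * (d * V / θ)) + 1, by positivity, fun K F c h hh hK hsub p hp => ?_⟩
  have hhd : 0 < h ^ d := by positivity
  have harea : h * ∑ e ∈ F, (surf e).real Set.univ ≤ d * V / θ * h ^ d := by
    have := hK.surface_le hd hh hsub
    rw [div_mul_eq_mul_div, le_div_iff₀ hθ]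
    linarith
  have hclos : closure K ⊆ Metric.closedBall c (2 * h) :=
    closure_minimal hsub Metric.isClosed_closedBall
  have hbound : ∀ p ∈ Poly d m, ∀ x ∈ Metric.closedBall c (2 * h),
      val p x ^ 2 ≤ C * ((h ^ d)⁻¹ * ∫ z in K, val p z ^ 2) := fun p hp x hx => by
    refine (hsup p hp c h hh x hx).trans ?_
    gcongr
    · exact Filter.Eventually.of_forall fun x => sq_nonneg (val p x)
    · exact hK.integrableOn (by fun_prop)
    · exact hK.ball_subset
  have hsum : ∀ (g : Pt d → ℝ) (S : ℝ), Continuous g →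
      (∀ x ∈ Metric.closedBall c (2 * h), g x ≤ S) →
      ∑ e ∈ F, ∫ x, g x ∂(surf e) ≤ S * ∑ e ∈ F, (surf e).real Set.univ := by
    intro g S hg hS
    rw [Finset.mul_sum]
    refine Finset.sum_le_sum fun e he => ?_
    have := hK.isFiniteMeasure_surf he
    calc ∫ x, g x ∂(surf e) ≤ ∫ _, S ∂(surf e) := by
          refine integral_mono_ae (hK.integrable_surf he hg) (integrable_const S) ?_
          filter_upwards [hK.ae_surf_mem he] with x hx
          exact hS x (hclos (frontier_subset_closure (hK.subset_frontier e he hx)))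
      _ = _ := by simp [mul_comm]
  have key : ∀ I : ℝ, 0 ≤ I → C * ((h ^ d)⁻¹ * I) * (h * ∑ e ∈ F, (surf e).real Set.univ) ≤
      C * (d * V / θ) * I := fun I hI => by
    calc _ ≤ C * ((h ^ d)⁻¹ * I) * (d * V / θ * h ^ d) := by gcongr
      _ = _ := by field_simp
  constructor
  · have hI : 0 ≤ ∫ x in K, val p x ^ 2 := integral_nonneg fun x => sq_nonneg _
    have h1 := hsum (fun x => val p x ^ 2) _ (by fun_prop) (hbound p hp)
    have h2 := key _ hI
    have h3 : 0 ≤ C * (d * V / θ) * ∫ x in K, val p x ^ 2 := by positivity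
    nlinarith
  · have hI : 0 ≤ ∫ x in K, ‖grad p x‖ ^ 2 := integral_nonneg fun x => by positivity
    have hgrad : ∀ x ∈ Metric.closedBall c (2 * h),
        ‖grad p x‖ ^ 2 ≤ C * ((h ^ d)⁻¹ * ∫ z in K, ‖grad p z‖ ^ 2) := fun x hx => by
      simp only [norm_grad_sq]
      rw [integral_finsetSum _ fun i _ => hK.integrableOn (by fun_prop), Finset.mul_sum,
        Finset.mul_sum]
      exact Finset.sum_le_sum fun i _ =>
        hbound _ (poly_mono (Nat.sub_le m 1) (pderiv_mem_poly hp i)) x hx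
    set G := C * ((h ^ d)⁻¹ * ∫ z in K, ‖grad p z‖ ^ 2) with hG
    have hG0 : 0 ≤ G := by positivity
    have hosc : ∀ x ∈ Metric.closedBall c (2 * h), (val p x - val p c) ^ 2 ≤ 4 * h ^ 2 * G := by
      intro x hx
      have hxc : ‖x - c‖ ≤ 2 * h := by rwa [← dist_eq_norm]
      -- Mean value inequality on the segment from c to x, which stays in the ball where the
      -- gradient bound holds even if it leaves K.
      have h1 := norm_image_sub_le_of_norm_deriv_le_segment_01'
        (f := fun s : ℝ => val p (c + s • (x - c))) (C := 2 * h * Real.sqrt G)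
        (fun s _ => (hasDerivAt_val_line p c (x - c) s).hasDerivWithinAt) (fun s hs => by
          refine (norm_inner_le_norm _ _).trans ?_
          refine mul_le_mul hxc ?_ (norm_nonneg _) (by positivity)
          refine Real.le_sqrt_of_sq_le (hgrad _ ?_)
          rw [Metric.mem_closedBall, dist_eq_norm, add_sub_cancel_left, norm_smul,
            Real.norm_of_nonneg hs.1]
          nlinarith [hs.2, norm_nonneg (x - c)])
      simp only [one_smul, zero_smul, add_zero, add_sub_cancel, Real.norm_eq_abs] at h1
      rw [← sq_abs]
      calc _ ≤ (2 * h * Real.sqrt G) ^ 2 := by gcongr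
        _ = _ := by rw [mul_pow, Real.sq_sqrt hG0]; ring
    have h1 := hsum (fun x => (val p x - val p c) ^ 2) _ (by fun_prop) hosc
    have h2 := key _ hI
    calc _ ≤ _ := h1
      _ = 4 * h * (G * (h * ∑ e ∈ F, (surf e).real Set.univ)) := by ring
      _ ≤ 4 * h * (C * (d * V / θ) * ∫ x in K, ‖grad p x‖ ^ 2) := by gcongr
      _ ≤ _ := by
        have : 0 ≤ h * ∫ x in K, ‖grad p x‖ ^ 2 := by positivity
        nlinarith

/-! ### Projections -/

/-- A linear functional that vanishes on the kernel of a symmetric bilinear form on a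
finite-dimensional space is represented by the form. -/
lemma exists_representative {V : Type*} [AddCommGroup V] [Module ℝ V] [FiniteDimensional ℝ V]
    (B : V →ₗ[ℝ] V →ₗ[ℝ] ℝ) (hB : ∀ v w, B v w = B w v) (L : V →ₗ[ℝ] ℝ)
    (hL : ∀ v, B v v = 0 → L v = 0) : ∃ p, ∀ q, B p q = L q := by
  -- In finite dimension the range of the dual map is the annihilator of the kernel.
  have hmem : L ∈ LinearMap.range (LinearMap.dualMap (M₂ := Module.Dual ℝ V) B) := by
    rw [LinearMap.range_dualMap_eq_dualAnnihilator_ker, Submodule.mem_dualAnnihilator]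
    intro v hv
    exact hL v (by rw [LinearMap.mem_ker.1 hv]; rfl)
  obtain ⟨φ, hφ⟩ := hmem
  obtain ⟨p, rfl⟩ := (Module.evalEquiv ℝ V).surjective φ
  exact ⟨p, fun q => by rw [hB, ← hφ]; rfl⟩

/-- The projection onto polynomials exists, if polynomials are integrable. -/
lemma isPolyProj_polyProj {μ : Measure (Pt d)} (hμ : ∀ g : Pt d → ℝ, Continuous g →
    Integrable g μ) (m : ℕ) (w : MvPolynomial (Fin d) ℝ) :
    IsPolyProj μ m (val w) (polyProj μ m (val w)) := by
  have hμ2 : ∀ p q : MvPolynomial (Fin d) ℝ, Integrable (fun x => val p x * val q x) μ :=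
    fun p q => hμ _ (by fun_prop)
  let B : Poly d m →ₗ[ℝ] Poly d m →ₗ[ℝ] ℝ := LinearMap.mk₂ ℝ
    (fun p q => ∫ x, val p.1 x * val q.1 x ∂μ)
    (fun p p' q => by
      simp only [Submodule.coe_add, val_add, add_mul]
      exact integral_add (hμ2 _ _) (hμ2 _ _))
    (fun a p q => by
      simp only [Submodule.coe_smul, val_smul, mul_assoc, integral_const_mul, smul_eq_mul])
    (fun p q q' => by
      simp only [Submodule.coe_add, val_add, mul_add]
      exact integral_add (hμ2 _ _) (hμ2 _ _))
    (fun a p q => by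
      simp only [Submodule.coe_smul, val_smul, mul_left_comm _ a, integral_const_mul, smul_eq_mul])
  let L : Poly d m →ₗ[ℝ] ℝ :=
    { toFun := fun q => ∫ x, val w x * val q.1 x ∂μ
      map_add' := fun q q' => by
        simp only [Submodule.coe_add, val_add, mul_add]
        exact integral_add (hμ2 _ _) (hμ2 _ _)
      map_smul' := fun a q => by
        simp only [Submodule.coe_smul, val_smul, mul_left_comm _ a, integral_const_mul,
          smul_eq_mul, RingHom.id_apply] }
  refine Classical.epsilon_spec (p := IsPolyProj μ m (val w)) ?_
  -- The form may be degenerate, as polynomials can vanish on a hyperplane; but its null vectors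
  -- vanish almost everywhere, so the functional vanishes on them too.
  obtain ⟨p, hp⟩ := exists_representative B (fun p q => by simp [B, mul_comm]) L (fun q hq => by
    have h0 : (fun x => val q.1 x * val q.1 x) =ᵐ[μ] 0 :=
      (integral_eq_zero_iff_of_nonneg (fun x => mul_self_nonneg _) (hμ2 _ _)).1 hq
    refine integral_eq_zero_of_ae ?_
    filter_upwards [h0] with x hx
    have : val q.1 x = 0 := by simpa using hx
    simp [this])
  exact ⟨p.1, p.2, fun q hq => hp ⟨q, hq⟩⟩

namespace IsPolyProj

variable {μ : Measure (Pt d)} {m : ℕ} {w p : MvPolynomial (Fin d) ℝ}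

lemma integral_sub_mul (hμ : ∀ g : Pt d → ℝ, Continuous g → Integrable g μ)
    (h : IsPolyProj μ m (val w) p) {q : MvPolynomial (Fin d) ℝ} (hq : q ∈ Poly d m) :
    ∫ x, (val w x - val p x) * val q x ∂μ = 0 := by
  have hμ2 : ∀ p q : MvPolynomial (Fin d) ℝ, Integrable (fun x => val p x * val q x) μ :=
    fun p q => hμ _ (by fun_prop)
  simp only [sub_mul]
  rw [integral_sub (hμ2 _ _) (hμ2 _ _), h.2 q hq, sub_self]

/-- The projection error is smaller than the distance to any constant. -/
lemma integral_sub_sq_le (hμ : ∀ g : Pt d → ℝ, Continuous g → Integrable g μ)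
    (h : IsPolyProj μ m (val w) p) (a : ℝ) :
    ∫ x, (val w x - val p x) ^ 2 ∂μ ≤ ∫ x, (val w x - a) ^ 2 ∂μ := by
  -- Pythagoras: constants belong to P_m for every m, so w - p is orthogonal to p - a.
  have hq : p - MvPolynomial.C a ∈ Poly d m :=
    Submodule.sub_mem _ h.1 (mem_poly_iff.2 (by simp))
  have h0 := h.integral_sub_mul hμ hq
  have i1 : Integrable (fun x => (val w x - val p x) ^ 2) μ := hμ _ (by fun_prop)
  have i2 : Integrable (fun x => (val p x - a) ^ 2) μ := hμ _ (by fun_prop)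
  have i3 : Integrable (fun x => (val w x - val p x) * val (p - MvPolynomial.C a) x) μ :=
    hμ _ (by fun_prop)
  have hexp : ∫ x, (val w x - a) ^ 2 ∂μ = ∫ x, (val w x - val p x) ^ 2 ∂μ +
      2 * (∫ x, (val w x - val p x) * val (p - MvPolynomial.C a) x ∂μ) +
      ∫ x, (val p x - a) ^ 2 ∂μ := by
    rw [← integral_const_mul, ← integral_add i1 (i3.const_mul 2),
      ← integral_add (hμ _ (by fun_prop)) i2]
    refine integral_congr_ae (Filter.Eventually.of_forall fun x => ?_)
    simp only [val_sub, val_C]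
    ring
  have : 0 ≤ ∫ x, (val p x - a) ^ 2 ∂μ := integral_nonneg fun x => sq_nonneg _
  rw [hexp, h0]
  linarith

end IsPolyProj

end HDG

namespace HDG

variable {d : ℕ}

/-! ### The size of an element -/

section Size

variable {K : Set (Pt d)}

lemma bddBelow_size (hne : K.Nonempty) :
    BddBelow {δ : ℝ | ∃ c : Pt d, K ⊆ Metric.closedBall c (δ / 2)} := by
  refine ⟨0, ?_⟩
  rintro δ ⟨c, hc⟩
  obtain ⟨x, hx⟩ := hne
  have := dist_nonneg.trans (Metric.mem_closedBall.1 (hc hx))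
  linarith

lemma size_le (hne : K.Nonempty) {x : Pt d} {R : ℝ} (h : K ⊆ Metric.closedBall x R) :
    size K ≤ 2 * R :=
  csInf_le (bddBelow_size hne) ⟨x, by rwa [mul_div_cancel_left₀ R two_ne_zero]⟩

lemma nonempty_size (hK : Bornology.IsBounded K) :
    {δ : ℝ | ∃ c : Pt d, K ⊆ Metric.closedBall c (δ / 2)}.Nonempty := by
  obtain ⟨R, hR⟩ := hK.subset_closedBall 0
  exact ⟨2 * R, 0, by rwa [mul_div_cancel_left₀ R two_ne_zero]⟩

lemma size_pos (hd : 0 < d) (hK : Bornology.IsBounded K) (hopen : IsOpen K) (hne : K.Nonempty) :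
    0 < size K := by
  obtain ⟨x, hx⟩ := hne
  obtain ⟨ε, hε, hball⟩ := Metric.isOpen_iff.1 hopen x hx
  refine lt_of_lt_of_le (half_pos hε) (le_csInf (nonempty_size hK) ?_)
  rintro δ ⟨c, hc⟩
  set v : Pt d := EuclideanSpace.single ⟨0, hd⟩ (ε / 2) with hv
  have hnv : ‖v‖ = ε / 2 := by
    rw [hv, PiLp.norm_single, Real.norm_of_nonneg (by positivity)]
  have h1 := hc (hball (Metric.mem_ball_self hε))
  have h2 := hc (hball (show x + v ∈ Metric.ball x ε by
    rw [Metric.mem_ball, dist_eq_norm, add_sub_cancel_left, hnv]; linarith))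
  have h3 := dist_triangle_right (x + v) x c
  rw [dist_eq_norm, add_sub_cancel_left, hnv] at h3
  rw [Metric.mem_closedBall] at h1 h2
  linarith

/-- The infimum need not be known to be attained, so a containing ball of diameter below 2 `size K`
is used; the distance of two points of K is at most that diameter. -/
lemma subset_closedBall_size (hK : Bornology.IsBounded K) (hpos : 0 < size K) {c : Pt d}
    (hc : c ∈ K) : K ⊆ Metric.closedBall c (2 * size K) := by
  obtain ⟨δ, ⟨c', hc'⟩, hδ⟩ := exists_lt_of_csInf_lt (nonempty_size hK)
    (show size K < 2 * size K by linarith)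
  intro x hx
  have h1 := Metric.mem_closedBall.1 (hc' hx)
  have h2 := Metric.mem_closedBall.1 (hc' hc)
  have h3 := dist_triangle_right x c c'
  rw [Metric.mem_closedBall]
  linarith

end Size

/-! ### Mesh elements as star-shaped polytopes -/

namespace PolyMesh

variable {Ω : Set (Pt d)} (M : PolyMesh d Ω)

open scoped Classical in
/-- The faces of an element. -/
noncomputable def facesOf (K : Set (Pt d)) : Finset (Set (Pt d)) :=
  M.faces.filter fun e => e ⊆ frontier K

lemma isOpen_elem (K : M.elems) : IsOpen K.1 := by
  obtain ⟨U, hU, h⟩ := (M.elem_polytope K.1 K.2).relOpen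
  rw [h]; simpa using hU

lemma bounded_elem (K : M.elems) : Bornology.IsBounded K.1 := (M.elem_polytope K.1 K.2).bounded

lemma nonempty_elem (K : M.elems) : K.1.Nonempty := (M.elem_polytope K.1 K.2).connected.nonempty

lemma size_elem_pos (hd : 0 < d) (K : M.elems) : 0 < size K.1 :=
  size_pos hd (M.bounded_elem K) (M.isOpen_elem K) (M.nonempty_elem K)

lemma exists_flatPiece (e : M.faces) : ∃ A : AffineSubspace ℝ (Pt d), FlatPiece A e.1 := by
  obtain ⟨A, hA, he⟩ := M.face_polytope e.1 e.2
  exact ⟨A, hA, he.bounded, he.connected.nonempty, he.relOpen⟩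

lemma integrable_face (e : M.faces) {g : Pt d → ℝ} (hg : Continuous g) :
    Integrable g (surf e.1) := by
  obtain ⟨A, hA⟩ := M.exists_flatPiece e
  exact hA.integrable_surf hg

lemma integrable_elem (K : M.elems) {g : Pt d → ℝ} (hg : Continuous g) : IntegrableOn g K.1 :=
  integrable_of_bounded (M.bounded_elem K) (M.bounded_elem K).measure_lt_top.ne
    (M.isOpen_elem K).measurableSet hg

lemma ae_face_mem (e : M.faces) : ∀ᵐ x ∂(surf e.1), x ∈ e.1 := by
  obtain ⟨A, hA⟩ := M.exists_flatPiece e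
  exact ae_restrict_mem hA.measurableSet

/-- The bridge from the mesh axioms to the geometry above. Both radii are fixed multiples of the
size of K, which makes all later constants scale-invariant. -/
lemma ShapeRegular.exists_starPolytope {M : PolyMesh d Ω} {θ ℓ : ℝ} (hM : M.ShapeRegular θ ℓ)
    (hd : 0 < d) (hθ : 0 < θ) (K : M.elems) :
    ∃ c, StarPolytope K.1 (M.facesOf K.1) c (θ * size K.1) ∧
      K.1 ⊆ Metric.closedBall c (2 * size K.1) := by
  classical
  obtain ⟨c, hc, hstar⟩ := hM.starShaped K.1 K.2
  have hpos := M.size_elem_pos hd K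
  refine ⟨c, ⟨⟨M.isOpen_elem K, M.bounded_elem K, mul_pos hθ hpos, hc, hstar⟩, fun e he => ?_,
    fun e he => ?_, fun e he e' he' => ?_, ?_⟩,
    subset_closedBall_size (M.bounded_elem K) hpos hc⟩
  · obtain ⟨A, hA, heA⟩ := M.face_polytope e (Finset.mem_filter.1 he).1
    exact ⟨A, ⟨hA, heA.bounded, heA.connected.nonempty, heA.relOpen⟩, heA.boundary⟩
  · exact (Finset.mem_filter.1 he).2
  · exact M.face_disjoint e (Finset.mem_filter.1 he).1 e' (Finset.mem_filter.1 he').1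
  · rw [M.frontier_elem K.1 K.2]
    refine Set.iUnion₂_subset fun e he => Set.iUnion_subset fun heK => ?_
    exact Set.subset_biUnion_of_mem (u := fun e => closure e)
      (show e ∈ (M.facesOf K.1 : Set (Set (Pt d))) from Finset.mem_filter.2 ⟨he, heK⟩)

open scoped Classical in
lemma sum_faces_eq (K : M.elems) (φ : Set (Pt d) → ℝ) :
    ∑ e : M.faces with e.1 ⊆ frontier K.1, φ e.1 = ∑ e ∈ M.facesOf K.1, φ e := by
  rw [facesOf, Finset.sum_filter, Finset.sum_filter,
    ← Finset.sum_coe_sort M.faces fun e => if e ⊆ frontier K.1 then φ e else 0]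

/-! ### Linearity and monotonicity of the integrals over the mesh -/

variable {M}

lemma elemInt_add {f g : M.elems → Pt d → ℝ} (hf : ∀ K, IntegrableOn (f K) K.1)
    (hg : ∀ K, IntegrableOn (g K) K.1) :
    M.elemInt (fun K x => f K x + g K x) = M.elemInt f + M.elemInt g := by
  rw [elemInt, elemInt, elemInt, ← Finset.sum_add_distrib]
  exact Finset.sum_congr rfl fun K _ => integral_add (hf K) (hg K)

lemma elemInt_sub {f g : M.elems → Pt d → ℝ} (hf : ∀ K, IntegrableOn (f K) K.1)
    (hg : ∀ K, IntegrableOn (g K) K.1) :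
    M.elemInt (fun K x => f K x - g K x) = M.elemInt f - M.elemInt g := by
  rw [elemInt, elemInt, elemInt, ← Finset.sum_sub_distrib]
  exact Finset.sum_congr rfl fun K _ => integral_sub (hf K) (hg K)

lemma elemInt_const_mul (a : ℝ) (f : M.elems → Pt d → ℝ) :
    M.elemInt (fun K x => a * f K x) = a * M.elemInt f := by
  rw [elemInt, elemInt, Finset.mul_sum]
  exact Finset.sum_congr rfl fun K _ => integral_const_mul _ _

lemma elemInt_mono {f g : M.elems → Pt d → ℝ} (hf : ∀ K, IntegrableOn (f K) K.1)
    (hg : ∀ K, IntegrableOn (g K) K.1) (h : ∀ K, ∀ x ∈ K.1, f K x ≤ g K x) :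
    M.elemInt f ≤ M.elemInt g :=
  Finset.sum_le_sum fun K _ =>
    setIntegral_mono_on (hf K) (hg K) (M.isOpen_elem K).measurableSet (h K)

lemma elemInt_nonneg {f : M.elems → Pt d → ℝ} (h : ∀ K x, 0 ≤ f K x) : 0 ≤ M.elemInt f :=
  Finset.sum_nonneg fun K _ => integral_nonneg (h K)

lemma bdryInt_add {f g : M.elems → M.faces → Pt d → ℝ} (hf : ∀ K e, Continuous (f K e))
    (hg : ∀ K e, Continuous (g K e)) :
    M.bdryInt (fun K e x => f K e x + g K e x) = M.bdryInt f + M.bdryInt g := by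
  simp only [bdryInt, ← Finset.sum_add_distrib]
  exact Finset.sum_congr rfl fun K _ => Finset.sum_congr rfl fun e _ =>
    integral_add (M.integrable_face e (hf K e)) (M.integrable_face e (hg K e))

lemma bdryInt_sub {f g : M.elems → M.faces → Pt d → ℝ} (hf : ∀ K e, Continuous (f K e))
    (hg : ∀ K e, Continuous (g K e)) :
    M.bdryInt (fun K e x => f K e x - g K e x) = M.bdryInt f - M.bdryInt g := by
  simp only [bdryInt, ← Finset.sum_sub_distrib]
  exact Finset.sum_congr rfl fun K _ => Finset.sum_congr rfl fun e _ =>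
    integral_sub (M.integrable_face e (hf K e)) (M.integrable_face e (hg K e))

lemma bdryInt_const_mul (a : ℝ) (f : M.elems → M.faces → Pt d → ℝ) :
    M.bdryInt (fun K e x => a * f K e x) = a * M.bdryInt f := by
  simp only [bdryInt, Finset.mul_sum]
  exact Finset.sum_congr rfl fun K _ => Finset.sum_congr rfl fun e _ => integral_const_mul _ _

lemma bdryInt_mono {f g : M.elems → M.faces → Pt d → ℝ} (hf : ∀ K e, Continuous (f K e))
    (hg : ∀ K e, Continuous (g K e))
    (h : ∀ (K : M.elems) (e : M.faces), e.1 ⊆ frontier K.1 → ∀ x ∈ e.1, f K e x ≤ g K e x) :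
    M.bdryInt f ≤ M.bdryInt g := by
  classical
  refine Finset.sum_le_sum fun K _ => Finset.sum_le_sum fun e he => ?_
  refine integral_mono_ae (M.integrable_face e (hf K e)) (M.integrable_face e (hg K e)) ?_
  filter_upwards [M.ae_face_mem e] with x hx using h K e (Finset.mem_filter.1 he).2 x hx

lemma bdryInt_nonneg {f : M.elems → M.faces → Pt d → ℝ} (h : ∀ K e x, 0 ≤ f K e x) :
    0 ≤ M.bdryInt f :=
  Finset.sum_nonneg fun K _ => Finset.sum_nonneg fun e _ => integral_nonneg (h K e)

@[fun_prop] lemma continuous_traceGap (l : ℕ) (w : M.Scal) (μ : M.Skel) (K : M.elems)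
    (e : M.faces) : Continuous (M.traceGap l w μ K e) := by
  unfold traceGap
  fun_prop

/-! ### Consequences of the divergence theorem -/

variable {θ ℓ : ℝ}

lemma elemInt_pderiv (hM : M.ShapeRegular θ ℓ) (hd : 0 < d) (hθ : 0 < θ) (g : M.Scal)
    (i : Fin d) :
    M.elemInt (fun K => val (MvPolynomial.pderiv i (g K))) =
      M.bdryInt fun K e x => val (g K) x * outerNormal K.1 e.1 i := by
  refine Finset.sum_congr rfl fun K _ => ?_
  obtain ⟨c, hK, -⟩ := hM.exists_starPolytope hd hθ K
  rw [hK.integral_pderiv hd,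
    M.sum_faces_eq K fun e => ∫ x, val (g K) x * outerNormal K.1 e i ∂(surf e)]

lemma elemInt_sum {ι : Type*} (s : Finset ι) {f : ι → M.elems → Pt d → ℝ}
    (hf : ∀ i K, IntegrableOn (f i K) K.1) :
    M.elemInt (fun K x => ∑ i ∈ s, f i K x) = ∑ i ∈ s, M.elemInt (f i) := by
  simp only [elemInt]
  rw [Finset.sum_comm]
  exact Finset.sum_congr rfl fun K _ => integral_finsetSum _ fun i _ => hf i K

lemma bdryInt_sum {ι : Type*} (s : Finset ι) {f : ι → M.elems → M.faces → Pt d → ℝ}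
    (hf : ∀ i K e, Continuous (f i K e)) :
    M.bdryInt (fun K e x => ∑ i ∈ s, f i K e x) = ∑ i ∈ s, M.bdryInt (f i) := by
  induction s using Finset.cons_induction with
  | empty => simp [bdryInt]
  | cons a s ha ih =>
    simp only [Finset.sum_cons]
    rw [bdryInt_add (hf a) (fun K e => by have := fun i => hf i K e; fun_prop), ih]

/-- Integration by parts on the elements. -/
lemma elemInt_mul_div (hM : M.ShapeRegular θ ℓ) (hd : 0 < d) (hθ : 0 < θ) (w : M.Scal)
    (r : M.Vect) :
    M.elemInt (fun K x => val (w K) x * div (r K) x) =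
      M.bdryInt (fun K e x => val (w K) x * inner ℝ (vval (r K) x) (outerNormal K.1 e.1)) -
      M.elemInt (fun K x => inner ℝ (grad (w K) x) (vval (r K) x)) := by
  have h : ∀ i, M.elemInt (fun K => val (MvPolynomial.pderiv i (w K * r K i))) =
      M.bdryInt fun K e x => val (w K * r K i) x * outerNormal K.1 e.1 i :=
    fun i => elemInt_pderiv hM hd hθ (fun K => w K * r K i) i
  have h' := Finset.sum_congr (rfl : (Finset.univ : Finset (Fin d)) = _) fun i _ => h i
  -- Summing over i the divergence theorem for w rᵢ; the product rule gives the two volume terms.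
  rw [← elemInt_sum _ fun i K => M.integrable_elem K (by fun_prop),
    ← bdryInt_sum _ fun i K e => by fun_prop] at h'
  rw [eq_sub_iff_add_eq, ← elemInt_add (fun K => M.integrable_elem K (by fun_prop))
    (fun K => M.integrable_elem K (by fun_prop))]
  convert h' using 4 with K x K e x
  · simp only [div, inner_eq_sum, Finset.mul_sum, ← Finset.sum_add_distrib, grad_apply, vval_apply,
      Derivation.leibniz, smul_eq_mul, val_add, val_mul]
    exact Finset.sum_congr rfl fun i _ => by ring
  · funext x
    simp only [inner_eq_sum, Finset.mul_sum, vval_apply, val_mul]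
    exact Finset.sum_congr rfl fun i _ => by ring

/-- The outer normals of the two elements at an interior face cancel. -/
lemma sum_outerNormal (hM : M.ShapeRegular θ ℓ) (hd : 0 < d) (hθ : 0 < θ) (e : M.faces)
    (he : ¬ e.1 ⊆ frontier Ω) [DecidablePred fun K : M.elems => e.1 ⊆ frontier K.1] :
    ∑ K : M.elems with e.1 ⊆ frontier K.1, outerNormal K.1 e.1 = 0 := by
  classical
  obtain ⟨A, hA⟩ := M.exists_flatPiece e
  have hnormal : ∀ K : M.elems, e.1 ⊆ frontier K.1 →
      IsOuterNormal K.1 e.1 (outerNormal K.1 e.1) := fun K hK => by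
    obtain ⟨c, hc, -⟩ := hM.exists_starPolytope hd hθ K
    exact (hc.outerNormal_spec hA hK).1
  have hneg : ∀ K K' : M.elems, K ≠ K' → e.1 ⊆ frontier K.1 → e.1 ⊆ frontier K'.1 →
      outerNormal K'.1 e.1 = - outerNormal K.1 e.1 := fun K K' hne hK hK' =>
    (hnormal K hK).eq_neg_of_disjoint (hnormal K' hK') hA.nonempty
      (M.elem_disjoint K.1 K.2 K'.1 K'.2 fun h => hne (Subtype.ext h))
  obtain ⟨h, -⟩ | ⟨-, K₁, h₁, K₂, h₂, hne, he₁, he₂⟩ := M.face_cases e.1 e.2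
  · exact absurd h he
  set L₁ : M.elems := ⟨K₁, h₁⟩
  set L₂ : M.elems := ⟨K₂, h₂⟩
  have hL : L₁ ≠ L₂ := fun h => hne (congrArg Subtype.val h)
  -- A third element at e would have a normal opposite to two opposite normals, forcing a unit
  -- vector to be zero.
  have hset : (Finset.univ.filter fun K : M.elems => e.1 ⊆ frontier K.1) = {L₁, L₂} := by
    ext K
    simp only [Finset.mem_filter, Finset.mem_univ, true_and, Finset.mem_insert,
      Finset.mem_singleton]
    constructor
    · intro hK
      by_contra! hcon
      have e1 := hneg L₁ K hcon.1.symm he₁ hK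
      have e2 := hneg L₂ K hcon.2.symm he₂ hK
      have e3 := hneg L₁ L₂ hL he₁ he₂
      rw [e1, e3, neg_neg] at e2
      have h0 : outerNormal L₁.1 e.1 = 0 := by
        have h2 : (2 : ℝ) • outerNormal L₁.1 e.1 = 0 := by
          rw [two_smul]
          nth_rewrite 1 [← e2]
          exact neg_add_cancel _
        exact (smul_eq_zero.1 h2).resolve_left two_ne_zero
      have h1 := (hnormal L₁ he₁).1
      rw [h0, norm_zero] at h1
      exact zero_ne_one h1
    · rintro (rfl | rfl)
      · exact he₁
      · exact he₂
  rw [hset, Finset.sum_pair hL, hneg L₁ L₂ hL he₁ he₂, add_neg_cancel]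

/-- The flux of a single-valued function that vanishes on the boundary faces is zero. -/
lemma bdryInt_singleValued (hM : M.ShapeRegular θ ℓ) (hd : 0 < d) (hθ : 0 < θ)
    (g : M.faces → Pt d → ℝ) (hg : ∀ e : M.faces, e.1 ⊆ frontier Ω → ∀ x ∈ e.1, g e x = 0)
    (i : Fin d) : M.bdryInt (fun K e x => g e x * outerNormal K.1 e.1 i) = 0 := by
  classical
  -- Reordered face by face, g factors out of the sum over the adjacent elements and only the sum of
  -- normals remains.
  rw [bdryInt, Finset.sum_congr rfl fun K _ => Finset.sum_filter _ _, Finset.sum_comm]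
  refine Finset.sum_eq_zero fun e _ => ?_
  rw [← Finset.sum_filter]
  simp only [integral_mul_const]
  rw [← Finset.mul_sum]
  by_cases he : e.1 ⊆ frontier Ω
  · have : ∫ x, g e x ∂(surf e.1) = 0 := by
      refine integral_eq_zero_of_ae ?_
      filter_upwards [M.ae_face_mem e] with x hx using hg e he x hx
    rw [this, zero_mul]
  · have h := congrArg (fun v : Pt d => v i) (sum_outerNormal hM hd hθ e he)
    simp only [WithLp.ofLp_sum, Finset.sum_apply, PiLp.zero_apply] at h
    rw [h, mul_zero]

end PolyMesh

end HDG

/-! ### The operator 𝒦_h and the discrete Poincaré inequality -/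

namespace HDG

namespace PolyMesh

variable {d : ℕ} {Ω : Set (Pt d)} {M : PolyMesh d Ω} {θ ℓ : ℝ}

/-- The defining property of `𝒦_h`. -/
lemma isKh_Kh (k : ℕ) (w : M.Scal) (μ : M.Skel) : M.IsKh k w μ (M.Kh k w μ) := by
  refine Classical.epsilon_spec (p := M.IsKh k w μ) ?_
  let ι : (M.elems → Fin d → Poly d (k - 1)) → M.Vect := fun q K i => (q K i).1
  have hadd : ∀ q q' K x, vval (ι (q + q') K) x = vval (ι q K) x + vval (ι q' K) x :=
    fun q q' K x => by ext i; simp [ι]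
  have hsmul : ∀ (a : ℝ) q K x, vval (ι (a • q) K) x = a • vval (ι q K) x :=
    fun a q K x => by ext i; simp [ι]
  have hdadd : ∀ q q' K x, div (ι (q + q') K) x = div (ι q K) x + div (ι q' K) x :=
    fun q q' K x => by simp [ι, div, Finset.sum_add_distrib]
  have hdsmul : ∀ (a : ℝ) q K x, div (ι (a • q) K) x = a * div (ι q K) x :=
    fun a q K x => by simp [ι, div, Finset.mul_sum]
  let B : (M.elems → Fin d → Poly d (k - 1)) →ₗ[ℝ] (M.elems → Fin d → Poly d (k - 1)) →ₗ[ℝ] ℝ :=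
    LinearMap.mk₂ ℝ
      (fun q r => M.elemInt fun K x => inner ℝ (vval (ι q K) x) (vval (ι r K) x))
      (fun q q' r => by
        simp only [hadd, inner_add_left]
        exact elemInt_add (fun K => M.integrable_elem K (by fun_prop))
          (fun K => M.integrable_elem K (by fun_prop)))
      (fun a q r => by
        simp only [hsmul, inner_smul_left, conj_trivial, elemInt_const_mul, smul_eq_mul])
      (fun q r r' => by
        simp only [hadd, inner_add_right]
        exact elemInt_add (fun K => M.integrable_elem K (by fun_prop))
          (fun K => M.integrable_elem K (by fun_prop)))
      (fun a q r => by
        simp only [hsmul, inner_smul_right, elemInt_const_mul, smul_eq_mul])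
  let L : (M.elems → Fin d → Poly d (k - 1)) →ₗ[ℝ] ℝ :=
    { toFun := fun r => - M.elemInt (fun K x => val (w K) x * div (ι r K) x)
        + M.bdryInt (fun K e x => val (μ e) x * inner ℝ (vval (ι r K) x) (outerNormal K.1 e.1))
      map_add' := fun r r' => by
        simp only [hadd, hdadd, inner_add_left, mul_add]
        rw [elemInt_add (fun K => M.integrable_elem K (by fun_prop))
          (fun K => M.integrable_elem K (by fun_prop)),
          bdryInt_add (fun K e => by fun_prop) (fun K e => by fun_prop)]
        ring
      map_smul' := fun a r => by
        simp only [hsmul, hdsmul, inner_smul_left, conj_trivial, mul_left_comm _ a,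
          elemInt_const_mul, bdryInt_const_mul, smul_eq_mul, RingHom.id_apply]
        ring }
  obtain ⟨q, hq⟩ := exists_representative B
    (fun q r => by simp only [B, LinearMap.mk₂_apply, real_inner_comm]) L (fun q hq => by
      -- On open elements the form is positive definite, so the kernel condition is trivial.
      suffices q = 0 by rw [this, map_zero]
      have hq' : M.elemInt (fun K x => inner ℝ (vval (ι q K) x) (vval (ι q K) x)) = 0 := hq
      have hK := (Finset.sum_eq_zero_iff_of_nonneg fun K _ =>
        integral_nonneg fun x => real_inner_self_nonneg).1 hq'
      funext K i
      refine Subtype.ext (eq_zero_of_integral_sq_eq_zero (M.isOpen_elem K) (M.nonempty_elem K)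
        (M.integrable_elem K (by fun_prop)) (le_antisymm ?_ (integral_nonneg fun x => sq_nonneg _)))
      rw [← hK K (Finset.mem_univ K)]
      refine integral_mono (M.integrable_elem K (by fun_prop)) (M.integrable_elem K (by fun_prop))
        fun x => ?_
      simp only [inner_eq_sum, vval_apply, ← sq]
      exact Finset.single_le_sum (f := fun i => val (q K i).1 x ^ 2) (fun i _ => sq_nonneg _)
        (Finset.mem_univ i))
  exact ⟨ι q, fun K i => (q K i).2, fun r hr => hq fun K i => ⟨r K i, hr K i⟩⟩

lemma isPolyProj_face (e : M.faces) (l : ℕ) (w : MvPolynomial (Fin d) ℝ) :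
    IsPolyProj (surf e.1) l (val w) (polyProj (surf e.1) l (val w)) :=
  isPolyProj_polyProj (fun _ hg => M.integrable_face e hg) l w

/-- The scaled trace inequalities, summed over the mesh. -/
lemma exists_bdry_const (hd : 0 < d) (m : ℕ) (hθ : 0 < θ) :
    ∃ C > 0, ∀ {Ω : Set (Pt d)} (M : PolyMesh d Ω) (ℓ : ℝ), M.ShapeRegular θ ℓ → ∀ w ∈ M.Vh m,
      M.bdryInt (fun K _ x => size K.1 * val (w K) x ^ 2) ≤
        C * M.elemInt (fun K x => val (w K) x ^ 2) ∧
      ∀ l, M.bdryInt (fun K e x => (size K.1)⁻¹ *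
          (val (w K) x - val (polyProj (surf e.1) l (val (w K))) x) ^ 2) ≤
        C * M.elemInt (fun K x => ‖grad (w K) x‖ ^ 2) := by
  classical
  obtain ⟨C, hC, h⟩ := exists_trace_const hd m hθ
  refine ⟨C, hC, fun {Ω} M ℓ hM w hw => ⟨?_, fun l => ?_⟩⟩
  · rw [elemInt, Finset.mul_sum]
    refine Finset.sum_le_sum fun K _ => ?_
    obtain ⟨c, hK, hsub⟩ := hM.exists_starPolytope hd hθ K
    have := (h K.1 _ c _ (M.size_elem_pos hd K) hK hsub (w K) (hw K)).1
    simp only [integral_const_mul]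
    rw [← Finset.mul_sum, M.sum_faces_eq K fun e => ∫ x, val (w K) x ^ 2 ∂(surf e)]
    exact this
  · rw [elemInt, Finset.mul_sum]
    refine Finset.sum_le_sum fun K _ => ?_
    obtain ⟨c, hK, hsub⟩ := hM.exists_starPolytope hd hθ K
    have hpos := M.size_elem_pos hd K
    have h2 := (h K.1 _ c _ hpos hK hsub (w K) (hw K)).2
    simp only [integral_const_mul]
    rw [← Finset.mul_sum, inv_mul_le_iff₀ hpos]
    -- The comparison function is one constant, the value of w at the star centre; it lies in P_l
    -- even for l = 0.
    calc _ ≤ ∑ e : M.faces with e.1 ⊆ frontier K.1,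
          ∫ x, (val (w K) x - val (w K) c) ^ 2 ∂(surf e.1) := Finset.sum_le_sum fun e _ =>
            (isPolyProj_face e l (w K)).integral_sub_sq_le (fun _ hg => M.integrable_face e hg) _
      _ = ∑ e ∈ M.facesOf K.1, ∫ x, (val (w K) x - val (w K) c) ^ 2 ∂(surf e) :=
          M.sum_faces_eq K fun e => ∫ x, (val (w K) x - val (w K) c) ^ 2 ∂(surf e)
      _ ≤ _ := h2.trans_eq (by ring)

/-- The gradient in terms of `𝒦_h` and the stabilization. -/
lemma elemInt_Kh_grad (hM : M.ShapeRegular θ ℓ) (hd : 0 < d) (hθ : 0 < θ) {k l : ℕ}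
    (hl : k - 1 ≤ l) {w : M.Scal} (hw : w ∈ M.Vh k) (μ : M.Skel) :
    M.elemInt (fun K x => ‖grad (w K) x‖ ^ 2) =
      M.elemInt (fun K x => inner ℝ (vval (M.Kh k w μ K) x) (grad (w K) x)) +
      M.bdryInt (fun K e x => M.traceGap l w μ K e x *
        inner ℝ (grad (w K) x) (outerNormal K.1 e.1)) := by
  set r : M.Vect := fun K i => MvPolynomial.pderiv i (w K) with hr
  have hrQ : r ∈ M.Qh k := fun K i => pderiv_mem_poly (hw K) i
  have h1 := (isKh_Kh k w μ).2 r hrQ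
  rw [elemInt_mul_div hM hd hθ w r] at h1
  have hvr : ∀ K x, vval (r K) x = grad (w K) x := fun K x => rfl
  simp only [hvr, real_inner_self_eq_norm_sq] at h1
  -- The normal is constant on e, so ∇w·n ∈ P_{k-1} ⊆ P_l is orthogonal to the projection error.
  -- This is where k - 1 ≤ l is needed.
  have h2 : M.bdryInt (fun K e x => (val (w K) x - val (polyProj (surf e.1) l (val (w K))) x) *
      inner ℝ (grad (w K) x) (outerNormal K.1 e.1)) = 0 := by
    refine Finset.sum_eq_zero fun K _ => Finset.sum_eq_zero fun e _ => ?_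
    have hq : ∑ i, outerNormal K.1 e.1 i • MvPolynomial.pderiv i (w K) ∈ Poly d l :=
      Submodule.sum_mem _ fun i _ => Submodule.smul_mem _ _
        (poly_mono hl (pderiv_mem_poly (hw K) i))
    have := (isPolyProj_face e l (w K)).integral_sub_mul (fun _ hg => M.integrable_face e hg) hq
    simpa only [val_sum, val_smul, inner_eq_sum, grad_apply, mul_comm (outerNormal K.1 e.1 _)]
      using this
  have h3 : M.bdryInt (fun K e x => M.traceGap l w μ K e x *
        inner ℝ (grad (w K) x) (outerNormal K.1 e.1)) =
      M.bdryInt (fun K e x => val (w K) x * inner ℝ (grad (w K) x) (outerNormal K.1 e.1)) -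
      M.bdryInt (fun K e x => val (μ e) x * inner ℝ (grad (w K) x) (outerNormal K.1 e.1)) -
      M.bdryInt (fun K e x => (val (w K) x - val (polyProj (surf e.1) l (val (w K))) x) *
        inner ℝ (grad (w K) x) (outerNormal K.1 e.1)) := by
    rw [← bdryInt_sub (fun K e => by fun_prop) (fun K e => by fun_prop),
      ← bdryInt_sub (fun K e => by fun_prop) (fun K e => by fun_prop)]
    congr 1
    funext K e x
    simp only [traceGap]
    ring
  rw [h3, h2, h1]
  ring

/-- Cancellation of the fluxes of single-valued functions in the identity behind the Poincaré
inequality. -/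
lemma elemInt_sq_eq (hM : M.ShapeRegular θ ℓ) (hd : 0 < d) (hθ : 0 < θ) {l : ℕ} (w : M.Scal)
    {μ : M.Skel} (hμ : μ ∈ M.Vhat l) (i : Fin d) (a : ℝ) :
    M.elemInt (fun K x => val (w K) x ^ 2) =
      M.bdryInt (fun K e x => (val (w K) x ^ 2 - val (μ e) x ^ 2) * (x i - a) *
        outerNormal K.1 e.1 i) -
      M.elemInt (fun K x => 2 * val (w K) x * val (MvPolynomial.pderiv i (w K)) x * (x i - a)) := by
  -- The factor xᵢ - a has derivative 1, which produces w² itself in the volume.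
  have h1 := elemInt_pderiv hM hd hθ
    (fun K => w K ^ 2 * (MvPolynomial.X i - MvPolynomial.C a)) i
  have h2 := bdryInt_singleValued hM hd hθ (fun e x => val (μ e) x ^ 2 * (x i - a))
    (fun e he x hx => by simp [(hμ e).2 he x hx]) i
  rw [eq_sub_iff_add_eq, ← elemInt_add (fun K => M.integrable_elem K (by fun_prop))
    (fun K => M.integrable_elem K (by fun_prop))]
  have h3 : M.bdryInt (fun K e x => (val (w K) x ^ 2 - val (μ e) x ^ 2) * (x i - a) *
        outerNormal K.1 e.1 i) =
      M.bdryInt (fun K e x => val (w K ^ 2 * (MvPolynomial.X i - MvPolynomial.C a)) x *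
        outerNormal K.1 e.1 i) -
      M.bdryInt (fun K e x => val (μ e) x ^ 2 * (x i - a) * outerNormal K.1 e.1 i) := by
    rw [← bdryInt_sub (fun K e => by fun_prop) (fun K e => by fun_prop)]
    congr 1
    funext K e x
    simp only [val_mul, val_pow, val_sub, val_X, val_C]
    ring
  rw [h3, h2, sub_zero, ← h1]
  congr 1
  funext K x
  simp only [Derivation.leibniz, Derivation.leibniz_pow, map_sub, MvPolynomial.pderiv_X_self,
    MvPolynomial.pderiv_C, smul_eq_mul, nsmul_eq_mul, val_add, val_mul, val_sub, val_X, val_C,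
    val_pow, val_one, val_zero]
  simp [val]
  ring

end PolyMesh

end HDG

namespace HDG

namespace PolyMesh

variable {d : ℕ} {Ω : Set (Pt d)} {M : PolyMesh d Ω} {θ ℓ : ℝ}

/-- The discrete gradient estimate: the broken gradient is bounded by the mesh-dependent norm. -/
lemma elemInt_grad_le (hM : M.ShapeRegular θ ℓ) (hd : 0 < d) (hθ : 0 < θ) {k l : ℕ}
    (hl : k - 1 ≤ l) {w : M.Scal} (hw : w ∈ M.Vh k) (μ : M.Skel) {C : ℝ} (hC : 0 < C)
    (htr : M.bdryInt (fun K _ x => size K.1 * ‖grad (w K) x‖ ^ 2) ≤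
      C * M.elemInt (fun K x => ‖grad (w K) x‖ ^ 2)) :
    M.elemInt (fun K x => ‖grad (w K) x‖ ^ 2) ≤ (2 + 2 * C) * M.tripleNormSq k l w μ := by
  have h1 := elemInt_Kh_grad hM hd hθ hl hw μ
  have h2 : M.elemInt (fun K x => inner ℝ (vval (M.Kh k w μ K) x) (grad (w K) x)) ≤
      M.elemInt (fun K x => ‖vval (M.Kh k w μ K) x‖ ^ 2) +
        1 / 4 * M.elemInt (fun K x => ‖grad (w K) x‖ ^ 2) := by
    rw [← elemInt_const_mul, ← elemInt_add (fun K => M.integrable_elem K (by fun_prop))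
      (fun K => M.integrable_elem K (by fun_prop))]
    refine elemInt_mono (fun K => M.integrable_elem K (by fun_prop))
      (fun K => M.integrable_elem K (by fun_prop)) fun K x _ => ?_
    have := real_inner_le_norm (vval (M.Kh k w μ K) x) (grad (w K) x)
    nlinarith [sq_nonneg (‖vval (M.Kh k w μ K) x‖ - 1 / 2 * ‖grad (w K) x‖)]
  -- The Young weight 1/(4C) is matched to the trace constant: with the quarter from the volume
  -- term, half of ‖∇w‖² is absorbed.
  have h3 : M.bdryInt (fun K e x => M.traceGap l w μ K e x *
        inner ℝ (grad (w K) x) (outerNormal K.1 e.1)) ≤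
      1 / (4 * C) * M.bdryInt (fun K _ x => size K.1 * ‖grad (w K) x‖ ^ 2) +
        C * M.bdryInt (fun K e x => (size K.1)⁻¹ * M.traceGap l w μ K e x ^ 2) := by
    rw [← bdryInt_const_mul, ← bdryInt_const_mul,
      ← bdryInt_add (fun K e => by fun_prop) (fun K e => by fun_prop)]
    refine bdryInt_mono (fun K e => by fun_prop) (fun K e => by fun_prop) fun K e he x _ => ?_
    obtain ⟨c, hK, -⟩ := hM.exists_starPolytope hd hθ K
    obtain ⟨A, hA⟩ := M.exists_flatPiece e
    have hn := (hK.outerNormal_spec hA he).1.1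
    have hpos := M.size_elem_pos hd K
    set h := size K.1
    set t := M.traceGap l w μ K e x
    have hi := abs_real_inner_le_norm (grad (w K) x) (outerNormal K.1 e.1)
    rw [hn, mul_one] at hi
    set g := ‖grad (w K) x‖
    calc t * inner ℝ (grad (w K) x) (outerNormal K.1 e.1) ≤ |t| * g := by
          refine (le_abs_self _).trans ?_
          rw [abs_mul]
          gcongr
      _ ≤ 1 / (4 * C) * (h * g ^ 2) + C * (h⁻¹ * |t| ^ 2) := by
          have : 1 / (4 * C) * (h * g ^ 2) + C * (h⁻¹ * |t| ^ 2) - |t| * g =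
              (h * g - 2 * C * |t|) ^ 2 / (4 * C * h) := by field_simp; ring
          have h0 : 0 ≤ (h * g - 2 * C * |t|) ^ 2 / (4 * C * h) := by positivity
          linarith
      _ = _ := by rw [sq_abs]
  have h4 : 1 / (4 * C) * M.bdryInt (fun K _ x => size K.1 * ‖grad (w K) x‖ ^ 2) ≤
      1 / 4 * M.elemInt (fun K x => ‖grad (w K) x‖ ^ 2) := by
    calc _ ≤ 1 / (4 * C) * (C * M.elemInt (fun K x => ‖grad (w K) x‖ ^ 2)) := by gcongr
      _ = _ := by field_simp
  have h5 : 0 ≤ M.elemInt (fun K x => ‖vval (M.Kh k w μ K) x‖ ^ 2) :=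
    elemInt_nonneg fun K x => by positivity
  have h6 : 0 ≤ M.bdryInt (fun K e x => (size K.1)⁻¹ * M.traceGap l w μ K e x ^ 2) :=
    bdryInt_nonneg fun K e x =>
      mul_nonneg (inv_nonneg.2 (M.size_elem_pos hd K).le) (sq_nonneg _)
  rw [tripleNormSq]
  nlinarith

/-- Pointwise estimate of the boundary terms in the Poincaré inequality. -/
lemma sq_sub_sq_mul_le {w m y n h C D : ℝ} (hh : 0 < h) (hC : 0 < C) (hD : 0 < D)
    (hhD : h ≤ 2 * D) (hy : |y| ≤ D) (hn : |n| ≤ 1) :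
    (w ^ 2 - m ^ 2) * y * n ≤
      1 / (4 * C) * (h * w ^ 2) + (4 * C * D ^ 2 + 2 * D ^ 2) * (h⁻¹ * (w - m) ^ 2) := by
  have hyn : |y * n| ≤ D := by
    rw [abs_mul]; nlinarith [abs_nonneg y, abs_nonneg n]
  have h1 : (w ^ 2 - m ^ 2) * y * n ≤ |w ^ 2 - m ^ 2| * D := by
    rw [mul_assoc]
    refine (le_abs_self _).trans ?_
    rw [abs_mul]
    gcongr
  have h2 : |w ^ 2 - m ^ 2| ≤ 2 * |w| * |w - m| + |w - m| ^ 2 := by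
    rw [show w ^ 2 - m ^ 2 = 2 * w * (w - m) - (w - m) ^ 2 by ring]
    refine (abs_sub _ _).trans ?_
    simp [abs_mul]
  have h3 : 2 * |w| * |w - m| * D ≤ 1 / (4 * C) * (h * |w| ^ 2) +
      4 * C * D ^ 2 * (h⁻¹ * |w - m| ^ 2) := by
    have : 1 / (4 * C) * (h * |w| ^ 2) + 4 * C * D ^ 2 * (h⁻¹ * |w - m| ^ 2) -
        2 * |w| * |w - m| * D = (h * |w| - 4 * C * D * |w - m|) ^ 2 / (4 * C * h) := by
      field_simp; ring
    have h0 : 0 ≤ (h * |w| - 4 * C * D * |w - m|) ^ 2 / (4 * C * h) := by positivity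
    linarith
  -- The quadratic remainder carries no inverse power of h; h ≤ 2D supplies it.
  have h4 : |w - m| ^ 2 * D ≤ 2 * D ^ 2 * (h⁻¹ * |w - m| ^ 2) := by
    have : 1 ≤ h⁻¹ * (2 * D) := by rw [inv_mul_eq_div, one_le_div hh]; exact hhD
    have h5 : 0 ≤ |w - m| ^ 2 * D := by positivity
    nlinarith
  rw [sq_abs] at h2 h3 h4
  rw [sq_abs] at h3
  nlinarith

/-- A Poincaré inequality for broken polynomials and single-valued traces. -/
lemma elemInt_sq_le (hM : M.ShapeRegular θ ℓ) (hd : 0 < d) (hθ : 0 < θ) {l : ℕ} (w : M.Scal)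
    {μ : M.Skel} (hμ : μ ∈ M.Vhat l) {x₀ : Pt d} {D : ℝ} (hD : 0 < D)
    (hΩ : Ω ⊆ Metric.closedBall x₀ D) {C : ℝ} (hC : 0 < C)
    (htr : M.bdryInt (fun K _ x => size K.1 * val (w K) x ^ 2) ≤
      C * M.elemInt (fun K x => val (w K) x ^ 2)) :
    M.elemInt (fun K x => val (w K) x ^ 2) ≤
      8 * D ^ 2 * M.elemInt (fun K x => ‖grad (w K) x‖ ^ 2) +
      (8 * C + 4) * D ^ 2 * M.bdryInt (fun K e x => (size K.1)⁻¹ *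
        (val (w K) x - val (μ e) x) ^ 2) := by
  set i : Fin d := ⟨0, hd⟩
  have h1 := elemInt_sq_eq hM hd hθ w hμ i (x₀ i)
  have hcoord : ∀ K : M.elems, ∀ x ∈ closure K.1, |x i - x₀ i| ≤ D := fun K x hx => by
    have hx' : x ∈ Metric.closedBall x₀ D :=
      closure_minimal ((M.elem_subset K.1 K.2).trans hΩ) Metric.isClosed_closedBall hx
    have := PiLp.norm_apply_le (x - x₀) i
    rw [← dist_eq_norm] at this
    exact this.trans hx'
  have h2 : - M.elemInt (fun K x => 2 * val (w K) x * val (MvPolynomial.pderiv i (w K)) x *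
        (x i - x₀ i)) ≤
      1 / 4 * M.elemInt (fun K x => val (w K) x ^ 2) +
        4 * D ^ 2 * M.elemInt (fun K x => ‖grad (w K) x‖ ^ 2) := by
    rw [← neg_one_mul, ← elemInt_const_mul, ← elemInt_const_mul, ← elemInt_const_mul,
      ← elemInt_add (fun K => M.integrable_elem K (by fun_prop))
      (fun K => M.integrable_elem K (by fun_prop))]
    refine elemInt_mono (fun K => M.integrable_elem K (by fun_prop))
      (fun K => M.integrable_elem K (by fun_prop)) fun K x hx => ?_
    have hy := hcoord K x (subset_closure hx)
    have hg : val (MvPolynomial.pderiv i (w K)) x ^ 2 ≤ ‖grad (w K) x‖ ^ 2 := by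
      rw [norm_grad_sq]
      exact Finset.single_le_sum (f := fun i => val (MvPolynomial.pderiv i (w K)) x ^ 2)
        (fun i _ => sq_nonneg _) (Finset.mem_univ i)
    have hy2 : (x i - x₀ i) ^ 2 ≤ D ^ 2 := by rw [← sq_abs]; gcongr
    set p := val (MvPolynomial.pderiv i (w K)) x
    have h3 : p ^ 2 * (x i - x₀ i) ^ 2 ≤ ‖grad (w K) x‖ ^ 2 * D ^ 2 := by gcongr
    nlinarith [sq_nonneg (1 / 2 * val (w K) x + 2 * (p * (x i - x₀ i)))]
  have h3 : M.bdryInt (fun K e x => (val (w K) x ^ 2 - val (μ e) x ^ 2) * (x i - x₀ i) *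
        outerNormal K.1 e.1 i) ≤
      1 / (4 * C) * M.bdryInt (fun K _ x => size K.1 * val (w K) x ^ 2) +
      (4 * C * D ^ 2 + 2 * D ^ 2) * M.bdryInt (fun K e x => (size K.1)⁻¹ *
        (val (w K) x - val (μ e) x) ^ 2) := by
    rw [← bdryInt_const_mul, ← bdryInt_const_mul,
      ← bdryInt_add (fun K e => by fun_prop) (fun K e => by fun_prop)]
    refine bdryInt_mono (fun K e => by fun_prop) (fun K e => by fun_prop) fun K e he x hx => ?_
    obtain ⟨c, hK, -⟩ := hM.exists_starPolytope hd hθ K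
    obtain ⟨A, hA⟩ := M.exists_flatPiece e
    have hn := (hK.outerNormal_spec hA he).1.1
    refine sq_sub_sq_mul_le (M.size_elem_pos hd K) hC hD
      (size_le (M.nonempty_elem K) ((M.elem_subset K.1 K.2).trans hΩ))
      (hcoord K x (frontier_subset_closure (he hx))) ?_
    exact (PiLp.norm_apply_le _ i).trans hn.le
  have h4 : 1 / (4 * C) * M.bdryInt (fun K _ x => size K.1 * val (w K) x ^ 2) ≤
      1 / 4 * M.elemInt (fun K x => val (w K) x ^ 2) := by
    calc _ ≤ 1 / (4 * C) * (C * M.elemInt (fun K x => val (w K) x ^ 2)) := by gcongr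
      _ = _ := by field_simp
  -- Half of ‖w‖² has been absorbed, a quarter from each estimate; this doubles the other constants.
  linarith

/-- The discrete Poincaré inequality. -/
theorem exists_poincare_const (hd : 0 < d) (hΩ : Bornology.IsBounded Ω) {k l : ℕ}
    (hl : k - 1 ≤ l) (hθ : 0 < θ) :
    ∃ C > 0, ∀ (M : PolyMesh d Ω) (ℓ : ℝ), M.ShapeRegular θ ℓ → ∀ w ∈ M.Vh k, ∀ μ ∈ M.Vhat l,
      M.elemInt (fun K x => val (w K) x ^ 2) ≤ C * M.tripleNormSq k l w μ := by
  obtain ⟨C, hC, hbd⟩ := exists_bdry_const (d := d) hd k hθ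
  obtain ⟨D, hD, hΩD⟩ := hΩ.subset_closedBall_lt 0 0
  set C₁ := 8 * D ^ 2 with hC₁
  set C₂ := (8 * C + 4) * D ^ 2 with hC₂
  refine ⟨(C₁ + 2 * C * C₂) * (2 + 2 * C) + 2 * C₂, by positivity, fun M ℓ hM w hw μ hμ => ?_⟩
  obtain ⟨htr, hproj⟩ := hbd M ℓ hM w hw
  have hpos := fun K => M.size_elem_pos hd K
  -- The trace inequality applies to each partial derivative, whose degree is at most k.
  have hgtr : M.bdryInt (fun K _ x => size K.1 * ‖grad (w K) x‖ ^ 2) ≤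
      C * M.elemInt (fun K x => ‖grad (w K) x‖ ^ 2) := by
    simp only [norm_grad_sq, Finset.mul_sum]
    rw [bdryInt_sum _ (fun i K e => by fun_prop),
      elemInt_sum _ (fun i K => M.integrable_elem K (by fun_prop)), Finset.mul_sum]
    exact Finset.sum_le_sum fun i _ => (hbd M ℓ hM (fun K => MvPolynomial.pderiv i (w K))
      fun K => poly_mono (Nat.sub_le k 1) (pderiv_mem_poly (hw K) i)).1
  have hG := elemInt_grad_le hM hd hθ hl hw μ hC hgtr
  have hW := elemInt_sq_le hM hd hθ w hμ hD hΩD hC htr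
  have hJ : M.bdryInt (fun K e x => (size K.1)⁻¹ * (val (w K) x - val (μ e) x) ^ 2) ≤
      2 * M.bdryInt (fun K e x => (size K.1)⁻¹ *
        (val (w K) x - val (polyProj (surf e.1) l (val (w K))) x) ^ 2) +
      2 * M.bdryInt (fun K e x => (size K.1)⁻¹ * M.traceGap l w μ K e x ^ 2) := by
    rw [← bdryInt_const_mul, ← bdryInt_const_mul,
      ← bdryInt_add (fun K e => by fun_prop) (fun K e => by fun_prop)]
    refine bdryInt_mono (fun K e => by fun_prop) (fun K e => by fun_prop) fun K e _ x _ => ?_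
    have h0 := inv_pos.2 (hpos K)
    simp only [traceGap]
    set p := val (polyProj (surf e.1) l (val (w K))) x
    nlinarith [mul_nonneg h0.le (sq_nonneg (val (w K) x - p - (p - val (μ e) x)))]
  have hS : M.bdryInt (fun K e x => (size K.1)⁻¹ * M.traceGap l w μ K e x ^ 2) ≤
      M.tripleNormSq k l w μ :=
    le_add_of_nonneg_left (elemInt_nonneg fun K x => by positivity)
  have hC₁0 : 0 < C₁ := by positivity
  have hC₂0 : 0 < C₂ := by positivity
  calc _ ≤ _ := hW
    _ ≤ C₁ * M.elemInt (fun K x => ‖grad (w K) x‖ ^ 2) +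
        C₂ * (2 * (C * M.elemInt (fun K x => ‖grad (w K) x‖ ^ 2)) +
          2 * M.tripleNormSq k l w μ) := by
      gcongr
      refine hJ.trans ?_
      gcongr
      exact hproj l
    _ = (C₁ + 2 * C * C₂) * M.elemInt (fun K x => ‖grad (w K) x‖ ^ 2) +
        2 * C₂ * M.tripleNormSq k l w μ := by ring
    _ ≤ (C₁ + 2 * C * C₂) * ((2 + 2 * C) * M.tripleNormSq k l w μ) +
        2 * C₂ * M.tripleNormSq k l w μ := by gcongr
    _ = _ := by ring

/-! ### The energy estimate -/

/-- On the diagonal the two volume terms cancel, and so do the two boundary terms, for any v: no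
integration by parts and no divergence condition on b(v) are needed. -/
lemma Bh_self (v u : M.Scal) (uhat : M.Skel) : M.Bh v u uhat u uhat = 0 := by
  have h1 : M.elemInt (fun K x => val (u K) x * inner ℝ (bvec d (val (v K) x)) (grad (u K) x)) =
      M.elemInt (fun K x => inner ℝ (bvec d (val (v K) x)) (grad (u K) x) * val (u K) x) := by
    simp only [mul_comm]
  have h2 : M.bdryInt (fun K e x =>
        inner ℝ (bvec d (val (v K) x)) (outerNormal K.1 e.1) * val (u K) x * val (uhat e) x) =
      M.bdryInt (fun K e x =>
        inner ℝ (bvec d (val (v K) x)) (outerNormal K.1 e.1) * val (uhat e) x * val (u K) x) := by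
    simp only [mul_right_comm]
  rw [Bh, h1, h2]
  ring

lemma Sh_self (l : ℕ) (ν : ℝ) (u : M.Scal) (uhat : M.Skel) :
    M.Sh l ν u uhat u uhat =
      ν * M.bdryInt (fun K e x => (size K.1)⁻¹ * M.traceGap l u uhat K e x ^ 2) := by
  simp only [Sh, mul_assoc, sq]

/-- The energy estimate for one time step. -/
lemma energy_step {k l N : ℕ} {ν T P : ℝ} (hν : 0 < ν) (hT : 0 < T) (hN : 0 < N) (hP : 0 < P)
    {u₀ : Pt d → ℝ} {f : ℝ → Pt d → ℝ} {q : ℕ → M.Vect} {u : ℕ → M.Scal} {uhat : ℕ → M.Skel}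
    (hu : M.IsBackwardEuler k l ν T N u₀ f q u uhat) {i : ℕ} (hi : 1 ≤ i) (hiN : i ≤ N)
    (hf : MemLp (f (i * (T / N))) 2 (volume.restrict Ω))
    (hpoin : M.elemInt (fun K x => val (u i K) x ^ 2) ≤ P * M.tripleNormSq k l (u i) (uhat i)) :
    M.normSq (fun K => val (u i K)) +
        M.normSq (fun K x => val (u i K) x - val (u (i - 1) K) x) +
        ν * (T / N) * M.tripleNormSq k l (u i) (uhat i) ≤
      M.normSq (fun K => val (u (i - 1) K)) +
        P * (T / N / ν * M.normSq (fun _ => f (i * (T / N)))) := by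
  obtain ⟨-, hV, hVhat⟩ := hu.mem i hi hiN
  have hstep := hu.step i hi hiN (u i) hV (uhat i) hVhat
  rw [Bh_self, Sh_self, add_zero] at hstep
  simp only [real_inner_self_eq_norm_sq] at hstep
  have hτ : 0 < T / N := by positivity
  set τ := T / N
  have hfi : ∀ K : M.elems, MemLp (f (i * τ)) 2 (volume.restrict K.1) := fun K =>
    hf.mono_measure (Measure.restrict_mono (M.elem_subset K.1 K.2) le_rfl)
  have hui : ∀ (j : ℕ) (K : M.elems), MemLp (val (u j K)) 2 (volume.restrict K.1) := fun j K =>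
    (memLp_two_iff_integrable_sq (by fun_prop)).2 (M.integrable_elem K (by fun_prop))
  -- With the weight ν/(2P), the Poincaré inequality turns the last term into ν/2 times the squared
  -- triple norm, half of the available dissipation.
  have hF : M.elemInt (fun K x => f (i * τ) x * val (u i K) x) ≤
      P / (2 * ν) * M.normSq (fun _ => f (i * τ)) +
        ν / (2 * P) * M.elemInt (fun K x => val (u i K) x ^ 2) := by
    rw [normSq, ← elemInt_const_mul, ← elemInt_const_mul,
      ← elemInt_add (fun K => (hfi K).integrable_sq.const_mul _)
        (fun K => (hui i K).integrable_sq.const_mul _)]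
    refine elemInt_mono (fun K => (hfi K).integrable_mul (hui i K))
      (fun K => ((hfi K).integrable_sq.const_mul _).add ((hui i K).integrable_sq.const_mul _))
      fun K x _ => ?_
    have : P / (2 * ν) * f (i * τ) x ^ 2 + ν / (2 * P) * val (u i K) x ^ 2 -
        f (i * τ) x * val (u i K) x =
          (P * f (i * τ) x - ν * val (u i K) x) ^ 2 / (2 * P * ν) := by field_simp; ring
    have h0 : 0 ≤ (P * f (i * τ) x - ν * val (u i K) x) ^ 2 / (2 * P * ν) := by positivity
    linarith
  -- Polarization: 2(a - b)a = a² + (a - b)² - b².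
  have hpol : M.elemInt (fun K x => (val (u i K) x - val (u (i - 1) K) x) / τ * val (u i K) x) =
      1 / (2 * τ) * (M.normSq (fun K => val (u i K)) +
        M.normSq (fun K x => val (u i K) x - val (u (i - 1) K) x) -
        M.normSq (fun K => val (u (i - 1) K))) := by
    rw [normSq, normSq, normSq, ← elemInt_add (fun K => M.integrable_elem K (by fun_prop))
      (fun K => M.integrable_elem K (by fun_prop)),
      ← elemInt_sub (fun K => M.integrable_elem K (by fun_prop))
      (fun K => M.integrable_elem K (by fun_prop)), ← elemInt_const_mul]
    congr 1
    funext K x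
    field_simp
    ring
  rw [hpol] at hstep
  have htriple : ν * M.elemInt (fun K x => ‖vval (M.Kh k (u i) (uhat i) K) x‖ ^ 2) +
      ν * M.bdryInt (fun K e x => (size K.1)⁻¹ * M.traceGap l (u i) (uhat i) K e x ^ 2) =
      ν * M.tripleNormSq k l (u i) (uhat i) := by
    rw [tripleNormSq, mul_add]
  have hP2 : ν / (2 * P) * M.elemInt (fun K x => val (u i K) x ^ 2) ≤
      ν / 2 * M.tripleNormSq k l (u i) (uhat i) := by
    calc _ ≤ ν / (2 * P) * (P * M.tripleNormSq k l (u i) (uhat i)) := by gcongr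
      _ = _ := by field_simp
  set X := M.normSq (fun K => val (u i K)) +
        M.normSq (fun K x => val (u i K) x - val (u (i - 1) K) x) -
        M.normSq (fun K => val (u (i - 1) K)) with hX
  set Z := M.tripleNormSq k l (u i) (uhat i)
  set Y := M.normSq (fun _ => f (i * τ))
  have hmain : 1 / (2 * τ) * X + ν / 2 * Z ≤ P / (2 * ν) * Y := by linarith
  have hmul : X + ν * τ * Z ≤ P * (τ / ν * Y) := by
    have := mul_le_mul_of_nonneg_left hmain (show 0 ≤ 2 * τ by positivity)
    calc X + ν * τ * Z = 2 * τ * (1 / (2 * τ) * X + ν / 2 * Z) := by field_simp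
      _ ≤ _ := this
      _ = _ := by field_simp
  linarith

end PolyMesh

end HDG


/-! ### The stability estimate -/

theorem mainTheorem6 (d : ℕ) (hd : d = 2 ∨ d = 3) (Ω : Set (HDG.Pt d))
    (hΩ : HDG.IsOpenPolytope ⊤ Ω) (k l : ℕ) (hk : 1 ≤ k) (hl : l = k ∨ l = k - 1)
    (θ ℓ : ℝ) (hθ : 0 < θ) (hℓ : 0 < ℓ) :
    ∃ C : ℝ, 0 < C ∧
      ∀ M : HDG.PolyMesh d Ω, M.ShapeRegular θ ℓ →
      ∀ (ν T : ℝ) (N : ℕ), 0 < ν → 0 < T → 0 < N →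
      ∀ (u₀ : HDG.Pt d → ℝ) (f : ℝ → HDG.Pt d → ℝ),
        MeasureTheory.MemLp u₀ 2 (MeasureTheory.volume.restrict Ω) →
        (∀ i : ℕ, 1 ≤ i → i ≤ N →
          MeasureTheory.MemLp (f (i * (T / N))) 2 (MeasureTheory.volume.restrict Ω)) →
      ∀ (q : ℕ → M.Vect) (u : ℕ → M.Scal) (uhat : ℕ → M.Skel),
        M.IsBackwardEuler k l ν T N u₀ f q u uhat →
      ∀ n : ℕ, 1 ≤ n → n ≤ N →
        M.normSq (fun K => HDG.val (u n K))
          + ∑ i ∈ Finset.Icc 1 n,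
              M.normSq (fun K x => HDG.val (u i K) x - HDG.val (u (i - 1) K) x)
          + ν * (T / N) * ∑ i ∈ Finset.Icc 1 n, M.tripleNormSq k l (u i) (uhat i)
        ≤ C * (M.normSq (fun K => HDG.val (u 0 K))
          + T / N / ν * ∑ i ∈ Finset.Icc 1 n, M.normSq (fun _ => f (i * (T / N)))) := by

  have hd0 : 0 < d := by omega
  obtain ⟨P, hP, hpoin⟩ := HDG.PolyMesh.exists_poincare_const (k := k) (l := l) hd0 hΩ.bounded
    (by omega) hθ
  -- The initial value enters with factor 1 and the source with the Poincaré constant P.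
  refine ⟨max 1 P, by positivity, fun M hM ν T N hν hT hN u₀ f _ hf q u uhat hu n _ hn => ?_⟩
  have hF : ∀ i, 0 ≤ M.normSq (fun _ => f (i * (T / N))) := fun i =>
    HDG.PolyMesh.elemInt_nonneg fun K x => sq_nonneg _
  have key : M.normSq (fun K => HDG.val (u n K))
      + ∑ i ∈ Finset.Icc 1 n, M.normSq (fun K x => HDG.val (u i K) x - HDG.val (u (i - 1) K) x)
      + ν * (T / N) * ∑ i ∈ Finset.Icc 1 n, M.tripleNormSq k l (u i) (uhat i)
      ≤ M.normSq (fun K => HDG.val (u 0 K))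
        + P * (T / N / ν * ∑ i ∈ Finset.Icc 1 n, M.normSq (fun _ => f (i * (T / N)))) := by
    -- Dropping 1 ≤ n lets the induction start at n = 0, where the sums are empty and both sides
    -- agree.
    clear * - hd0 hP hpoin hM hν hT hN hf hu hn
    induction n with
    | zero => simp
    | succ n ih =>
      have hstep := HDG.PolyMesh.energy_step hν hT hN hP hu (Nat.succ_pos n) hn
        (hf _ (Nat.succ_pos n) hn) (hpoin M ℓ hM _ (hu.mem _ (Nat.succ_pos n) hn).2.1 _
          (hu.mem _ (Nat.succ_pos n) hn).2.2)
      have ih := ih (by omega)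
      simp only [Finset.sum_Icc_succ_top (Nat.succ_pos n), mul_add]
      simp only [Nat.succ_eq_add_one, Nat.add_sub_cancel] at hstep ⊢
      linarith
  refine key.trans ?_
  have h0 : 0 ≤ M.normSq (fun K => HDG.val (u 0 K)) :=
    HDG.PolyMesh.elemInt_nonneg fun K x => sq_nonneg _
  have h1 : 0 ≤ T / N / ν * ∑ i ∈ Finset.Icc 1 n, M.normSq (fun _ => f (i * (T / N))) :=
    mul_nonneg (by positivity) (Finset.sum_nonneg fun i _ => hF i)
  rw [mul_add]
  exact add_le_add (le_mul_of_one_le_left h0 (le_max_left _ _))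
    (mul_le_mul_of_nonneg_right (le_max_right _ _) h1)
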